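/- Let $N\ge 2$, $\rho_-,\rho_+>0$, $V_-,V_+>0$ and $\gamma\ge 0$. Put $\mathbb R^N_-=\{x_1<0\}$, $\mathbb R^N_+=\{x_1>0\}$ and $\Sigma=\{x_1=0\}$ in $\mathbb R^N$. For a set $\Omega\subset\mathbb R^N$ of finite perimeter let $$\mathcal F(\Omega)=\rho_-P(\Omega,\mathbb R^N_-)+\rho_+P(\Omega,\mathbb R^N_+)+\gamma\,\mathcal H^{N-1}(\partial\Omega\cap\Sigma),$$ where $P(\Omega,A)$ is De Giorgi's perimeter of $\Omega$ relative to the open set $A$, $\partial\Omega$ is the topological boundary and $\mathcal H^{N-1}$ is the $(N-1)$-dimensional Hausdorff measure. A minimizer is a set that minimizes $\mathcal F$ among all sets $\Omega\subset\mathbb R^N$ of finite perimeter with $\rho_-|\Omega\cap\mathbb R^N_-|=V_-$ and $\rho_+|\Omega\cap\mathbb R^N_+|=V_+$. For $\alpha,\beta\in(0,\pi)$ and $R_-,R_+>0$ let $\Omega(\alpha,\beta,R_\pm)$ be the union of $\overline B(-R_-\cos\alpha\,e_1,R_-)\cap\{x_1\le 0\}$ and $\overline B(-R_+\cos\beta\,e_1,R_+)\cap\{x_1\ge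 0\}$; its two spherical caps $\Gamma_\pm=\partial\Omega\cap\mathbb R^N_\pm$ have as boundaries the spheres in $\Sigma$ centred at $0$ of radii $R_-\sin\alpha$ (for $\Gamma_-$) and $R_+\sin\beta$ (for $\Gamma_+$). It is called a type II minimizer if it is a minimizer and $R_-\sin\alpha\ne R_+\sin\beta$. **Theorem (Snell's law for type II minimizers).** Let $\Omega(\alpha,\beta,R_\pm)$ be a type II minimizer. If $R_-\sin\alpha>R_+\sin\beta$, then $$\rho_-\cos\alpha=\gamma=\rho_+\cos\beta .$$ If $R_-\sin\alpha<R_+\sin\beta$, then $$\rho_-\cos\alpha=-\gamma=\rho_+\cos\beta .$$ -/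

import Mathlib

open MeasureTheory
open scoped ENNReal

noncomputable section

namespace TwoPhase

/-- `ℝ^N` with its Euclidean norm. The coordinate `x₁` of the text is `x 0`. -/
abbrev Space (N : ℕ) : Type := EuclideanSpace ℝ (Fin N)

/-- The open half-space `{x₁ < 0}`. -/
def leftHalf (N : ℕ) [NeZero N] : Set (Space N) := {x | x 0 < 0}

/-- The open half-space `{x₁ > 0}`. -/
def rightHalf (N : ℕ) [NeZero N] : Set (Space N) := {x | 0 < x 0}

/-- The interface hyperplane `Σ = {x₁ = 0}`. -/
def interface (N : ℕ) [NeZero N] : Set (Space N) := {x | x 0 = 0}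

/-- The divergence `∑ i, ∂ᵢ Tᵢ` of a vector field. -/
def divergence {N : ℕ} (T : Space N → Space N) (x : Space N) : ℝ :=
  ∑ i : Fin N, (fderiv ℝ T x (EuclideanSpace.single i 1)) i

/-- Admissible test fields for the perimeter relative to `A`:
`C¹` fields, compactly supported inside `A`, with `|T| ≤ 1`. -/
structure IsTestField {N : ℕ} (A : Set (Space N)) (T : Space N → Space N) : Prop where
  contDiff : ContDiff ℝ 1 T
  hasCompactSupport : HasCompactSupport T
  tsupport_subset : tsupport T ⊆ A
  norm_le_one : ∀ x, ‖T x‖ ≤ 1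

/-- De Giorgi's relative perimeter
`P(Ω, A) = sup {∫_Ω div T : T ∈ C¹_c(A; ℝ^N), |T| ≤ 1}`, with values in `[0, ∞]`. -/
def perimeter {N : ℕ} (Ω A : Set (Space N)) : ℝ≥0∞ :=
  ⨆ (T : Space N → Space N) (_ : IsTestField A T),
    ENNReal.ofReal (∫ x in Ω, divergence T x)

/-- Sets of finite perimeter in `ℝ^N` (Lebesgue measurable, `P(Ω, ℝ^N) < ∞`). -/
def HasFinitePerimeter {N : ℕ} (Ω : Set (Space N)) : Prop :=
  NullMeasurableSet Ω volume ∧ perimeter Ω Set.univ < ∞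

/-- The weighted perimeter
`F(Ω) = ρ₋ P(Ω, ℝ^N₋) + ρ₊ P(Ω, ℝ^N₊) + γ H^{N-1}(∂Ω ∩ Σ)`.
Here `μHE[N - 1]` is the `(N-1)`-dimensional Hausdorff measure, normalised so that it agrees with
Lebesgue measure on `ℝ^{N-1}`. -/
def weightedPerimeter {N : ℕ} [NeZero N] (ρm ρp γ : ℝ) (Ω : Set (Space N)) : ℝ≥0∞ :=
  ENNReal.ofReal ρm * perimeter Ω (leftHalf N)
    + ENNReal.ofReal ρp * perimeter Ω (rightHalf N)
    + ENNReal.ofReal γ * μHE[N - 1] (frontier Ω ∩ interface N)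

/-- Competitors: sets of finite perimeter with `ρ₋|Ω₋| = V₋` and `ρ₊|Ω₊| = V₊`. -/
structure IsAdmissible {N : ℕ} [NeZero N] (ρm ρp Vm Vp : ℝ) (Ω : Set (Space N)) : Prop where
  finitePerimeter : HasFinitePerimeter Ω
  volume_left : ENNReal.ofReal ρm * volume (Ω ∩ leftHalf N) = ENNReal.ofReal Vm
  volume_right : ENNReal.ofReal ρp * volume (Ω ∩ rightHalf N) = ENNReal.ofReal Vp

/-- `Ω` minimizes the weighted perimeter among all competitors. -/
structure IsMinimizer {N : ℕ} [NeZero N] (ρm ρp Vm Vp γ : ℝ) (Ω : Set (Space N)) : Prop where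
  admissible : IsAdmissible ρm ρp Vm Vp Ω
  minimal : ∀ E : Set (Space N), IsAdmissible ρm ρp Vm Vp E →
    weightedPerimeter ρm ρp γ Ω ≤ weightedPerimeter ρm ρp γ E

/-- The set `Ω(α, β, R₋, R₊)`, rotationally symmetric about the `x₁`-axis: the part in `{x₁ ≤ 0}`
of the closed ball of radius `R₋` centred at `-R₋ cos α e₁`, together with the part in `{x₁ ≥ 0}`
of the closed ball of radius `R₊` centred at `-R₊ cos β e₁`. The two balls meet `Σ` in the
concentric discs of radii `R₋ sin α` and `R₊ sin β`. -/
def domes (N : ℕ) [NeZero N] (α β Rm Rp : ℝ) : Set (Space N) :=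
  (Metric.closedBall (EuclideanSpace.single 0 (-(Rm * Real.cos α))) Rm ∩ {x | x 0 ≤ 0})
    ∪ (Metric.closedBall (EuclideanSpace.single 0 (-(Rp * Real.cos β))) Rp ∩ {x | 0 ≤ x 0})

/-- `Ω(α, β, R₋, R₊)` is a type II minimizer: it is a minimizer, `Γ₋` and `Γ₊` are genuine
spherical caps (not whole spheres), and their boundary `(N-2)`-spheres, which lie in `Σ` and have
radii `R₋ sin α` and `R₊ sin β`, have distinct radii. -/
structure IsTypeIIMinimizer (N : ℕ) [NeZero N] (ρm ρp Vm Vp γ α β Rm Rp : ℝ) : Prop where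
  alpha_mem : α ∈ Set.Ioo 0 Real.pi
  beta_mem : β ∈ Set.Ioo 0 Real.pi
  radius_left_pos : 0 < Rm
  radius_right_pos : 0 < Rp
  radii_ne : Rm * Real.sin α ≠ Rp * Real.sin β
  isMinimizer : IsMinimizer ρm ρp Vm Vp γ (domes N α β Rm Rp)

end TwoPhase

end

noncomputable section

namespace TwoPhase

open Filter Topology Set

/-! ### Calculus of the divergence -/

/-! Each dome is deformed separately by the linear map diag(s⁻ⁿ, s, …, s), where n = N - 1. It has
determinant one and preserves `Σ` and both half-spaces, so the deformed sets remain admissible. It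
turns the contact radius a into s a, and the interface term becomes γ ω |(s a)ⁿ - bⁿ|, where ω is
the volume of the unit ball of ℝⁿ and b is the radius of the other dome. Since a ≠ b, this is
differentiable at s = 1.

The area of the deformed cap is only bounded from above. A test field with |T| ≤ 1 pulls back under
the deformation D to a field S on the original ball. With y = x - c on the sphere of centre c and
radius R, ⟨y, S⟩ ≤ |D⁻¹y| ≤ (R² + |D⁻¹y|²)/(2R). The last expression is quadratic in y, hence the
pairing of y with a diagonal linear field, whose flux through the cap is explicit: its trace times
the volume, minus a term from the disc on `Σ` (`capFlux`). This gives `perimeter_deformed_cap_le`.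
At s = 1 the linear field is the unit normal on the sphere and the bound is attained
(`ofReal_capFlux_le_perimeter`).

Hence `energyBound` lies above the energies of the competitors and touches them at s = t = 1, so
minimality of the domes makes this point a minimum of an explicit function. When one dome is
stretched, the volume term is stationary at s = 1; what remains is ρκ = ±γ, where Rκ is the signed
height of the centre of the ball (`snell_of_forall_le`).

Surface integrals never appear: smooth cutoffs of balls and half-spaces replace them, and
`integral_divergence_closedBall_mono` expresses that flux increases with the normal component. -/

theorem divergence_smul {N : ℕ} {φ : Space N → ℝ} {S : Space N → Space N} {x : Space N}
    (hφ : DifferentiableAt ℝ φ x) (hS : DifferentiableAt ℝ S x) :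
    divergence (fun y => φ y • S y) x = φ x * divergence S x + fderiv ℝ φ x (S x) := by
  have hsum : S x = ∑ i, (S x i) • (EuclideanSpace.single i 1 : Space N) := by
    ext j
    simp [Finset.sum_apply, Pi.single_apply]
  have h2 : fderiv ℝ φ x (S x) = ∑ i, fderiv ℝ φ x (EuclideanSpace.single i 1) * S x i := by
    conv_lhs => rw [hsum]
    simp [mul_comm]
  rw [h2]
  simp only [divergence]
  rw [Finset.mul_sum, ← Finset.sum_add_distrib]
  refine Finset.sum_congr rfl fun i _ => ?_
  rw [fderiv_fun_smul hφ hS]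
  simp

theorem divergence_add {N : ℕ} {S T : Space N → Space N} {x : Space N}
    (hS : DifferentiableAt ℝ S x) (hT : DifferentiableAt ℝ T x) :
    divergence (fun y => S y + T y) x = divergence S x + divergence T x := by
  simp only [divergence]
  rw [← Finset.sum_add_distrib]
  refine Finset.sum_congr rfl fun i _ => ?_
  rw [fderiv_fun_add hS hT]
  simp

theorem divergence_const_smul {N : ℕ} {S : Space N → Space N} {x : Space N} (r : ℝ)
    (hS : DifferentiableAt ℝ S x) :
    divergence (fun y => r • S y) x = r * divergence S x := by
  rw [divergence_smul (differentiableAt_const r) hS]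
  simp

theorem divergence_clm_sub {N : ℕ} (L : Space N →L[ℝ] Space N) (c x : Space N) :
    divergence (fun y => L (y - c)) x = ∑ i, L (EuclideanSpace.single i 1) i := by
  simp only [divergence]
  refine Finset.sum_congr rfl fun i _ => ?_
  have : HasFDerivAt (fun y => L (y - c)) L x :=
    L.hasFDerivAt.comp x ((hasFDerivAt_id x).sub_const c)
  rw [this.fderiv]

theorem divergence_congr {N : ℕ} {S T : Space N → Space N} {x : Space N}
    (h : S =ᶠ[𝓝 x] T) : divergence S x = divergence T x := by
  simp only [divergence, h.fderiv_eq]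

theorem continuous_divergence {N : ℕ} {S : Space N → Space N} (hS : ContDiff ℝ 1 S) :
    Continuous (divergence S) := by
  have h := hS.continuous_fderiv one_ne_zero
  unfold divergence
  fun_prop

theorem divergence_eq_zero_of_notMem_tsupport {N : ℕ} {S : Space N → Space N} {x : Space N}
    (hx : x ∉ tsupport S) : divergence S x = 0 := by
  have h : S =ᶠ[𝓝 x] fun _ => 0 := notMem_tsupport_iff_eventuallyEq.mp hx
  rw [divergence_congr h]
  simp [divergence]

theorem hasCompactSupport_divergence {N : ℕ} {S : Space N → Space N} (hS : HasCompactSupport S) :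
    HasCompactSupport (divergence S) :=
  HasCompactSupport.intro' hS (isClosed_tsupport S)
    fun _ hx => divergence_eq_zero_of_notMem_tsupport hx

theorem integral_divergence_eq_zero {N : ℕ} {S : Space N → Space N} (hS : ContDiff ℝ 1 S)
    (hc : HasCompactSupport S) : ∫ x, divergence S x = 0 := by
  have hd : Differentiable ℝ S := hS.differentiable one_ne_zero
  have hcont := hS.continuous_fderiv one_ne_zero
  have key : ∀ i : Fin N, ∀ x v, fderiv ℝ S x v i = fderiv ℝ (fun y => S y i) x v := by
    intro i x v
    have := ((EuclideanSpace.proj (𝕜 := ℝ) i).hasFDerivAt (x := S x)).comp x (hd x).hasFDerivAt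
    have h2 : HasFDerivAt (fun y => S y i)
        ((EuclideanSpace.proj (𝕜 := ℝ) i).comp (fderiv ℝ S x)) x := this
    rw [h2.fderiv]
    simp
  have hint : ∀ i : Fin N, Integrable fun x => fderiv ℝ S x (EuclideanSpace.single i 1) i := by
    intro i
    refine Continuous.integrable_of_hasCompactSupport (by fun_prop) ?_
    refine HasCompactSupport.intro' hc (isClosed_tsupport S) fun x hx => ?_
    have h : S =ᶠ[𝓝 x] fun _ => 0 := notMem_tsupport_iff_eventuallyEq.mp hx
    rw [h.fderiv_eq]
    simp
  have hSi : ∀ i : Fin N, Integrable fun x => S x i := by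
    intro i
    refine Continuous.integrable_of_hasCompactSupport (by have := hS.continuous; fun_prop) ?_
    refine HasCompactSupport.intro' hc (isClosed_tsupport S) fun x hx => ?_
    simp [image_eq_zero_of_notMem_tsupport hx]
  unfold divergence
  rw [integral_finsetSum _ fun i _ => hint i]
  refine Finset.sum_eq_zero fun i _ => ?_
  -- Integration by parts against the constant 1, whose derivative vanishes.
  have := integral_mul_fderiv_eq_neg_fderiv_mul_of_integrable (μ := (volume : Measure (Space N)))
    (f := fun _ => (1 : ℝ)) (g := fun y => S y i) (v := EuclideanSpace.single i 1)
    (by simp) (by simpa [← key] using hint i) (by simpa using hSi i) (by simp)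
    (fun x _ => ((EuclideanSpace.proj (𝕜 := ℝ) i).differentiableAt (x := S x)).comp x (hd x))
  simpa [key] using this

/-! ### Smooth steps -/

/-- A smooth step from `0` to `1` on the interval `[ε, 2ε]`. -/
def smoothStep (ε t : ℝ) : ℝ := Real.smoothTransition (t / ε - 1)

theorem contDiff_smoothStep (ε : ℝ) : ContDiff ℝ 1 (smoothStep ε) := by
  have : ContDiff ℝ 1 Real.smoothTransition := Real.smoothTransition.contDiff (n := 1)
  unfold smoothStep
  fun_prop

theorem smoothStep_nonneg (ε t : ℝ) : 0 ≤ smoothStep ε t := Real.smoothTransition.nonneg _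

theorem smoothStep_le_one (ε t : ℝ) : smoothStep ε t ≤ 1 := Real.smoothTransition.le_one _

theorem smoothStep_eq_zero {ε t : ℝ} (hε : 0 < ε) (ht : t ≤ ε) : smoothStep ε t = 0 := by
  apply Real.smoothTransition.zero_of_nonpos
  have := (div_le_one hε).2 ht
  linarith

theorem smoothStep_eq_one {ε t : ℝ} (hε : 0 < ε) (ht : 2 * ε ≤ t) : smoothStep ε t = 1 := by
  apply Real.smoothTransition.one_of_one_le
  have := (le_div_iff₀ hε).2 ht
  linarith

theorem monotone_smoothStep {ε : ℝ} (hε : 0 < ε) : Monotone (smoothStep ε) := by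
  intro a b hab
  apply Real.smoothTransition.monotone
  gcongr

theorem deriv_smoothStep_nonneg {ε : ℝ} (hε : 0 < ε) (t : ℝ) : 0 ≤ deriv (smoothStep ε) t :=
  (monotone_smoothStep hε).deriv_nonneg

theorem hasDerivAt_smoothStep (ε t : ℝ) : HasDerivAt (smoothStep ε) (deriv (smoothStep ε) t) t :=
  ((contDiff_smoothStep ε).differentiable one_ne_zero t).hasDerivAt

theorem continuous_deriv_smoothStep (ε : ℝ) : Continuous (deriv (smoothStep ε)) :=
  (contDiff_smoothStep ε).continuous_deriv le_rfl

theorem deriv_smoothStep_of_lt {ε t : ℝ} (hε : 0 < ε) (ht : t < ε) :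
    deriv (smoothStep ε) t = 0 := by
  have : smoothStep ε =ᶠ[𝓝 t] fun _ => 0 := by
    filter_upwards [Iio_mem_nhds ht] with u hu using smoothStep_eq_zero hε (le_of_lt hu)
  rw [this.deriv_eq]; simp

theorem deriv_smoothStep_of_gt {ε t : ℝ} (hε : 0 < ε) (ht : 2 * ε < t) :
    deriv (smoothStep ε) t = 0 := by
  have : smoothStep ε =ᶠ[𝓝 t] fun _ => 1 := by
    filter_upwards [Ioi_mem_nhds ht] with u hu using smoothStep_eq_one hε (le_of_lt hu)
  rw [this.deriv_eq]; simp

theorem tendsto_smoothStep (t : ℝ) :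
    Tendsto (fun ε => smoothStep ε t) (𝓝[>] 0) (𝓝 (if 0 < t then 1 else 0)) := by
  split_ifs with h
  · refine tendsto_const_nhds.congr' ?_
    filter_upwards [Ioo_mem_nhdsGT (half_pos h)] with ε hε
    exact (smoothStep_eq_one hε.1 (by linarith [hε.2])).symm
  · refine tendsto_const_nhds.congr' ?_
    filter_upwards [self_mem_nhdsWithin] with ε hε
    exact (smoothStep_eq_zero hε (by have : (0:ℝ) < ε := hε; linarith)).symm

/-! ### The sign of the flux through a sphere -/

/-- A smooth cutoff, equal to `1` near the closed ball of centre `c` and radius `R`. -/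
def ballCutoff {N : ℕ} (c : Space N) (R ε : ℝ) (x : Space N) : ℝ :=
  1 - smoothStep ε (‖x - c‖ ^ 2 - R ^ 2)

theorem contDiff_ballCutoff {N : ℕ} (c : Space N) (R ε : ℝ) : ContDiff ℝ 1 (ballCutoff c R ε) := by
  have h := contDiff_smoothStep ε
  have h2 : ContDiff ℝ 1 fun x : Space N => ‖x - c‖ ^ 2 - R ^ 2 :=
    ((contDiff_id.sub contDiff_const).norm_sq ℝ).sub contDiff_const
  exact contDiff_const.sub (h.comp h2)

theorem ballCutoff_nonneg {N : ℕ} (c : Space N) (R ε : ℝ) (x : Space N) :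
    0 ≤ ballCutoff c R ε x := by
  have := smoothStep_le_one ε (‖x - c‖ ^ 2 - R ^ 2)
  unfold ballCutoff; linarith

theorem ballCutoff_le_one {N : ℕ} (c : Space N) (R ε : ℝ) (x : Space N) :
    ballCutoff c R ε x ≤ 1 := by
  have := smoothStep_nonneg ε (‖x - c‖ ^ 2 - R ^ 2)
  unfold ballCutoff; linarith

theorem ballCutoff_eq_one {N : ℕ} {c : Space N} {R ε : ℝ} {x : Space N} (hε : 0 < ε)
    (hx : ‖x - c‖ ^ 2 ≤ R ^ 2 + ε) : ballCutoff c R ε x = 1 := by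
  unfold ballCutoff; rw [smoothStep_eq_zero hε (by linarith)]; simp

theorem ballCutoff_eq_zero {N : ℕ} {c : Space N} {R ε : ℝ} {x : Space N} (hε : 0 < ε)
    (hx : R ^ 2 + 2 * ε ≤ ‖x - c‖ ^ 2) : ballCutoff c R ε x = 0 := by
  unfold ballCutoff; rw [smoothStep_eq_one hε (by linarith)]; simp

theorem hasCompactSupport_ballCutoff {N : ℕ} (c : Space N) (R : ℝ) {ε : ℝ} (hε : 0 < ε) :
    HasCompactSupport (ballCutoff c R ε) := by
  refine HasCompactSupport.intro (isCompact_closedBall c (Real.sqrt (R ^ 2 + 2 * ε))) fun x hx => ?_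
  apply ballCutoff_eq_zero hε
  rw [Metric.mem_closedBall, dist_eq_norm, not_le] at hx
  exact (Real.lt_sq_of_sqrt_lt hx).le

theorem fderiv_ballCutoff {N : ℕ} (c : Space N) (R ε : ℝ) (x v : Space N) :
    fderiv ℝ (ballCutoff c R ε) x v =
      -(deriv (smoothStep ε) (‖x - c‖ ^ 2 - R ^ 2) * (2 * inner ℝ (x - c) v)) := by
  have h1 : HasFDerivAt (fun y : Space N => ‖y - c‖ ^ 2 - R ^ 2) (2 • innerSL ℝ (x - c)) x := by
    have := ((hasFDerivAt_id x).sub_const c).norm_sq.sub_const (R ^ 2)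
    simpa using this
  have h2 := ((hasDerivAt_smoothStep ε _).comp_hasFDerivAt x h1).const_sub 1
  have h3 : HasFDerivAt (ballCutoff c R ε) _ x := h2
  rw [h3.fderiv]
  simp [inner_sub_left]

/-- The cutoff times `S` has compact support, so its divergence integrates to zero. The right side
lives on the shell R² + ε ≤ ‖x - c‖² ≤ R² + 2ε and plays the part of the flux through the sphere. -/
theorem integral_ballCutoff_mul_divergence {N : ℕ} {S : Space N → Space N} (hS : ContDiff ℝ 1 S)
    (c : Space N) (R : ℝ) {ε : ℝ} (hε : 0 < ε) :
    ∫ x, ballCutoff c R ε x * divergence S x =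
      ∫ x, deriv (smoothStep ε) (‖x - c‖ ^ 2 - R ^ 2) * (2 * inner ℝ (x - c) (S x)) := by
  have hφ := contDiff_ballCutoff c R ε
  have hsup := hasCompactSupport_ballCutoff c R hε
  have h0 := integral_divergence_eq_zero (hφ.smul hS) hsup.smul_right
  have hdiv : ∀ x, divergence (fun y => ballCutoff c R ε y • S y) x =
      ballCutoff c R ε x * divergence S x -
        deriv (smoothStep ε) (‖x - c‖ ^ 2 - R ^ 2) * (2 * inner ℝ (x - c) (S x)) := by
    intro x
    rw [divergence_smul (hφ.differentiable one_ne_zero x) (hS.differentiable one_ne_zero x),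
      fderiv_ballCutoff]
    ring
  have hi1 : Integrable fun x => ballCutoff c R ε x * divergence S x :=
    (hφ.continuous.mul (continuous_divergence hS)).integrable_of_hasCompactSupport hsup.mul_right
  have hi2 : Integrable fun x => divergence (fun y => ballCutoff c R ε y • S y) x :=
    (continuous_divergence (hφ.smul hS)).integrable_of_hasCompactSupport
      (hasCompactSupport_divergence hsup.smul_right)
  have hsplit : ∀ x, deriv (smoothStep ε) (‖x - c‖ ^ 2 - R ^ 2) * (2 * inner ℝ (x - c) (S x)) =
      ballCutoff c R ε x * divergence S x - divergence (fun y => ballCutoff c R ε y • S y) x := by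
    intro x; rw [hdiv]; ring
  simp_rw [hsplit]
  rw [integral_sub hi1 hi2]
  have : ∫ x, divergence (fun y => ballCutoff c R ε y • S y) x = 0 := h0
  rw [this, sub_zero]

theorem tendsto_integral_ballCutoff {N : ℕ} {f : Space N → ℝ} (hf : Continuous f)
    (c : Space N) {R : ℝ} (hR : 0 < R) :
    Tendsto (fun ε => ∫ x, ballCutoff c R ε x * f x) (𝓝[>] 0)
      (𝓝 (∫ x in Metric.closedBall c R, f x)) := by
  rw [← integral_indicator measurableSet_closedBall]
  -- For ε < 1 the cutoff vanishes where ‖x - c‖² ≥ R² + 2, so `K` supports a common dominating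
  -- function.
  set K := Metric.closedBall c (Real.sqrt (R ^ 2 + 2))
  refine tendsto_integral_filter_of_dominated_convergence (K.indicator fun x => |f x|) ?_ ?_ ?_ ?_
  · exact Eventually.of_forall fun ε =>
      ((contDiff_ballCutoff c R ε).continuous.mul hf).aestronglyMeasurable
  · filter_upwards [Ioo_mem_nhdsGT (zero_lt_one (α := ℝ))] with ε hε
    refine Eventually.of_forall fun x => ?_
    by_cases hx : x ∈ K
    · rw [indicator_of_mem hx, Real.norm_eq_abs, abs_mul, abs_of_nonneg (ballCutoff_nonneg ..)]
      exact mul_le_of_le_one_left (abs_nonneg _) (ballCutoff_le_one ..)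
    · rw [indicator_of_notMem hx, ballCutoff_eq_zero hε.1]
      · simp
      · rw [Metric.mem_closedBall, dist_eq_norm, not_le] at hx
        have := Real.lt_sq_of_sqrt_lt hx
        linarith [hε.2]
  · rw [integrable_indicator_iff measurableSet_closedBall]
    exact hf.abs.continuousOn.integrableOn_compact (isCompact_closedBall _ _)
  · refine Eventually.of_forall fun x => ?_
    have h := (tendsto_smoothStep (‖x - c‖ ^ 2 - R ^ 2)).const_sub 1 |>.mul_const (f x)
    refine h.trans_eq ?_
    congr 1
    by_cases hx : x ∈ Metric.closedBall c R
    · rw [indicator_of_mem hx, if_neg]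
      · simp
      · rw [Metric.mem_closedBall, dist_eq_norm] at hx
        have := pow_le_pow_left₀ (norm_nonneg _) hx 2
        linarith
    · rw [indicator_of_notMem hx, if_pos]
      · simp
      · rw [Metric.mem_closedBall, dist_eq_norm, not_le] at hx
        have := pow_lt_pow_left₀ hx hR.le two_ne_zero
        linarith

theorem exists_shell_inner_neg {N : ℕ} {S : Space N → Space N} (hS : Continuous S)
    {c : Space N} {R : ℝ} (hR : 0 < R)
    (h : ∀ x ∈ Metric.sphere c R, inner ℝ (x - c) (S x) < 0) :
    ∃ η > 0, ∀ x, R ^ 2 ≤ ‖x - c‖ ^ 2 → ‖x - c‖ ^ 2 < R ^ 2 + η → inner ℝ (x - c) (S x) < 0 := by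
  have hopen : IsOpen {x | inner ℝ (x - c) (S x) < 0} :=
    isOpen_lt (by fun_prop) continuous_const
  obtain ⟨δ, hδ, hsub⟩ := (isCompact_sphere c R).exists_thickening_subset_open hopen h
  -- With r = ‖x - c‖ ≥ R, the bound (r - R)(r + R) < δR forces r - R < δ, and r - R is the distance
  -- from x to its radial projection on the sphere.
  refine ⟨δ * R, by positivity, fun x h1 h2 => hsub ?_⟩
  have h1' : R ≤ ‖x - c‖ := le_of_sq_le_sq h1 (norm_nonneg _)
  have hpos : 0 < ‖x - c‖ := hR.trans_le h1'
  rw [Metric.mem_thickening_iff]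
  refine ⟨c + (R / ‖x - c‖) • (x - c), ?_, ?_⟩
  · rw [mem_sphere_iff_norm, add_sub_cancel_left, norm_smul, Real.norm_eq_abs,
      abs_of_nonneg (by positivity), div_mul_cancel₀ _ hpos.ne']
  · rw [dist_eq_norm]
    have : x - (c + (R / ‖x - c‖) • (x - c)) = (1 - R / ‖x - c‖) • (x - c) := by
      rw [sub_smul, one_smul]; abel
    rw [this, norm_smul, Real.norm_eq_abs, abs_of_nonneg
      (by rw [sub_nonneg, div_le_one hpos]; exact h1'), sub_mul, div_mul_cancel₀ _ hpos.ne', one_mul]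
    nlinarith

/-- A strict sign on the compact sphere persists on a thin outer shell. There the smoothed flux is
nonpositive because the step is nondecreasing; then ε → 0. -/
theorem integral_divergence_closedBall_nonpos_of_neg {N : ℕ} {S : Space N → Space N}
    (hS : ContDiff ℝ 1 S) {c : Space N} {R : ℝ} (hR : 0 < R)
    (h : ∀ x ∈ Metric.sphere c R, inner ℝ (x - c) (S x) < 0) :
    ∫ x in Metric.closedBall c R, divergence S x ≤ 0 := by
  obtain ⟨η, hη, hneg⟩ := exists_shell_inner_neg hS.continuous hR h
  refine le_of_tendsto (tendsto_integral_ballCutoff (continuous_divergence hS) c hR) ?_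
  filter_upwards [Ioo_mem_nhdsGT (half_pos hη)] with ε hε
  rw [integral_ballCutoff_mul_divergence hS c R hε.1]
  refine integral_nonpos fun x => ?_
  rcases lt_or_ge (‖x - c‖ ^ 2 - R ^ 2) ε with h1 | h1
  · simp [deriv_smoothStep_of_lt hε.1 h1]
  rcases lt_or_ge (2 * ε) (‖x - c‖ ^ 2 - R ^ 2) with h2 | h2
  · simp [deriv_smoothStep_of_gt hε.1 h2]
  have := hneg x (by linarith [hε.1]) (by linarith [hε.2])
  exact mul_nonpos_of_nonneg_of_nonpos (deriv_smoothStep_nonneg hε.1 _) (by linarith)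

/-- If a `C¹` field points inwards along a sphere, its divergence has nonpositive integral
over the ball. -/
theorem integral_divergence_closedBall_nonpos {N : ℕ} {S : Space N → Space N}
    (hS : ContDiff ℝ 1 S) {c : Space N} {R : ℝ} (hR : 0 < R)
    (h : ∀ x ∈ Metric.sphere c R, inner ℝ (x - c) (S x) ≤ 0) :
    ∫ x in Metric.closedBall c R, divergence S x ≤ 0 := by
  set L : Space N →L[ℝ] Space N := ContinuousLinearMap.id ℝ _
  set v := volume.real (Metric.closedBall c R)
  have hint : IntegrableOn (divergence S) (Metric.closedBall c R) :=
    (continuous_divergence hS).continuousOn.integrableOn_compact (isCompact_closedBall _ _)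
  have hL : ContDiff ℝ 1 fun y => L (y - c) := L.contDiff.comp (contDiff_id.sub contDiff_const)
  -- Subtracting ε(x - c) lowers the pairing on the sphere by εR² > 0, which makes the sign strict,
  -- and lowers the divergence by the constant εN.
  have key : ∀ ε > 0, ∫ x in Metric.closedBall c R, divergence S x ≤ ε * (N * v) := by
    intro ε hε
    have h1 := integral_divergence_closedBall_nonpos_of_neg (c := c) (R := R)
      (hS.add (hL.const_smul (-ε))) hR (by
        intro x hx
        rw [mem_sphere_iff_norm] at hx
        have := h x (by rwa [mem_sphere_iff_norm])
        simp only [L, inner_add_right, inner_smul_right,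
          ContinuousLinearMap.id_apply, real_inner_self_eq_norm_sq, hx]
        have : 0 < ε * R ^ 2 := by positivity
        linarith)
    have h2 : ∀ x, divergence (fun y => S y + (-ε) • L (y - c)) x = divergence S x - ε * N := by
      intro x
      have hd := hL.differentiable one_ne_zero x
      have e1 := divergence_add (hS.differentiable one_ne_zero x) (hd.const_smul (-ε))
      have e2 := divergence_const_smul (-ε) hd
      rw [divergence_clm_sub] at e2
      have e3 : divergence (fun y => S y + (-ε) • L (y - c)) x =
        divergence S x + divergence (fun y => (-ε) • L (y - c)) x := e1
      rw [e3, e2]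
      simp [L]; ring
    simp_rw [h2] at h1
    rw [integral_sub hint (integrableOn_const (measure_closedBall_lt_top.ne))] at h1
    simp only [integral_const, MeasurableSet.univ, measureReal_restrict_apply, univ_inter,
      smul_eq_mul] at h1
    have : v * (ε * N) = ε * (N * v) := by ring
    linarith
  have ht : Tendsto (fun ε : ℝ => ε * (N * v)) (𝓝[>] 0) (𝓝 0) := by
    have : Tendsto (fun ε : ℝ => ε * (N * v)) (𝓝 0) (𝓝 (0 * (N * v))) :=
      tendsto_id.mul_const _
    rw [zero_mul] at this
    exact this.mono_left nhdsWithin_le_nhds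
  exact ge_of_tendsto ht (by filter_upwards [self_mem_nhdsWithin] with ε hε using key ε hε)

theorem integral_divergence_closedBall_mono {N : ℕ} {S T : Space N → Space N}
    (hS : ContDiff ℝ 1 S) (hT : ContDiff ℝ 1 T) {c : Space N} {R : ℝ} (hR : 0 < R)
    (h : ∀ x ∈ Metric.sphere c R, inner ℝ (x - c) (S x) ≤ inner ℝ (x - c) (T x)) :
    ∫ x in Metric.closedBall c R, divergence S x ≤ ∫ x in Metric.closedBall c R, divergence T x := by
  have hS' : IntegrableOn (divergence S) (Metric.closedBall c R) :=
    (continuous_divergence hS).continuousOn.integrableOn_compact (isCompact_closedBall _ _)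
  have hT' : IntegrableOn (divergence T) (Metric.closedBall c R) :=
    (continuous_divergence hT).continuousOn.integrableOn_compact (isCompact_closedBall _ _)
  have h1 := integral_divergence_closedBall_nonpos (c := c) (R := R)
    (hS.add (hT.const_smul (-1 : ℝ))) hR (by
      intro x hx
      have := h x hx
      simp only [inner_add_right, inner_smul_right]
      linarith)
  have h2 : ∀ x, divergence (fun y => S y + (-1 : ℝ) • T y) x = divergence S x - divergence T x := by
    intro x
    have hd := hT.differentiable one_ne_zero x
    have e1 : divergence (fun y => S y + (-1 : ℝ) • T y) x =
      divergence S x + divergence (fun y => (-1 : ℝ) • T y) x :=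
        divergence_add (hS.differentiable one_ne_zero x) (hd.const_smul (-1 : ℝ))
    rw [e1, divergence_const_smul _ hd]; ring
  simp_rw [h2] at h1
  rw [integral_sub hS' hT'] at h1
  linarith

/-! ### Slicing by the first coordinate -/

/-- Splitting off the first coordinate, `ℝ^(n+1) ≃ ℝ × ℝ^n`. -/
def splitEquiv (n : ℕ) : Space (n + 1) ≃ᵐ ℝ × Space n :=
  ((MeasurableEquiv.toLp 2 (Fin (n + 1) → ℝ)).symm.trans
    (MeasurableEquiv.piFinSuccAbove (fun _ => ℝ) 0)).trans
      ((MeasurableEquiv.refl ℝ).prodCongr (MeasurableEquiv.toLp 2 (Fin n → ℝ)))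

theorem splitEquiv_fst {n : ℕ} (x : Space (n + 1)) : (splitEquiv n x).1 = x 0 := rfl

theorem splitEquiv_snd {n : ℕ} (x : Space (n + 1)) (i : Fin n) :
    (splitEquiv n x).2 i = x i.succ := rfl

theorem measurePreserving_splitEquiv (n : ℕ) : MeasurePreserving (splitEquiv n) := by
  have h1 : MeasurePreserving (MeasurableEquiv.toLp 2 (Fin (n + 1) → ℝ)).symm :=
    PiLp.volume_preserving_ofLp (Fin (n + 1))
  have h2 := volume_preserving_piFinSuccAbove (fun _ : Fin (n + 1) => ℝ) 0
  have h3 : MeasurePreserving ((MeasurableEquiv.refl ℝ).prodCongr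
      (MeasurableEquiv.toLp 2 (Fin n → ℝ))) :=
    (MeasurePreserving.id volume).prod (PiLp.volume_preserving_toLp (Fin n))
  exact (h3.comp h2).comp h1

theorem norm_sq_eq_split {n : ℕ} (x : Space (n + 1)) :
    ‖x‖ ^ 2 = x 0 ^ 2 + ‖(splitEquiv n x).2‖ ^ 2 := by
  rw [EuclideanSpace.real_norm_sq_eq, EuclideanSpace.real_norm_sq_eq, Fin.sum_univ_succ]
  rfl

theorem norm_sub_single_sq {n : ℕ} (x : Space (n + 1)) (c : ℝ) :
    ‖x - EuclideanSpace.single 0 c‖ ^ 2 = (x 0 - c) ^ 2 + ‖(splitEquiv n x).2‖ ^ 2 := by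
  have h1 : (x - EuclideanSpace.single 0 c : Space (n + 1)) 0 = x 0 - c := by simp
  have h2 : (splitEquiv n (x - EuclideanSpace.single 0 c)).2 = (splitEquiv n x).2 := by
    ext i
    simp [splitEquiv_snd]
  rw [norm_sq_eq_split, h1, h2]

/-- The volume of the unit ball of `ℝ^n`. -/
def unitBallVolume (n : ℕ) : ℝ := volume.real (Metric.closedBall (0 : Space n) 1)

theorem unitBallVolume_pos (n : ℕ) : 0 < unitBallVolume n :=
  ENNReal.toReal_pos (Metric.measure_closedBall_pos _ _ one_pos).ne' measure_closedBall_lt_top.ne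

theorem volume_real_closedBall_eq {n : ℕ} {r : ℝ} (hr : 0 ≤ r) :
    volume.real (Metric.closedBall (0 : Space n) r) = unitBallVolume n * r ^ n := by
  have := Measure.addHaar_real_closedBall' (volume : Measure (Space n)) (0 : Space n) hr
  rw [this, finrank_euclideanSpace_fin, mul_comm]; rfl

/-- The area of the section at height `t` of a ball of radius `R` centred at height `c`. -/
def sliceArea (n : ℕ) (R c t : ℝ) : ℝ :=
  unitBallVolume n * Real.sqrt (R ^ 2 - (t - c) ^ 2) ^ n

theorem continuous_sliceArea (n : ℕ) (R c : ℝ) : Continuous (sliceArea n R c) := by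
  unfold sliceArea; fun_prop

/-- Where the section is empty the square root is truncated to 0, and n ≠ 0 is what makes its n-th
power vanish. -/
theorem volume_real_slice {n : ℕ} (hn : n ≠ 0) (R c t : ℝ) :
    volume.real {z : Space n | (t - c) ^ 2 + ‖z‖ ^ 2 ≤ R ^ 2} = sliceArea n R c t := by
  rcases le_or_gt 0 (R ^ 2 - (t - c) ^ 2) with h | h
  · rw [sliceArea, ← volume_real_closedBall_eq (Real.sqrt_nonneg _)]
    congr 1
    ext z
    rw [mem_ofPred_eq, mem_closedBall_zero_iff, Real.le_sqrt (norm_nonneg _) h]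
    constructor <;> intro <;> linarith
  · rw [sliceArea, Real.sqrt_eq_zero_of_nonpos h.le, zero_pow hn, mul_zero]
    have : {z : Space n | (t - c) ^ 2 + ‖z‖ ^ 2 ≤ R ^ 2} = ∅ := by
      ext z
      simp only [mem_ofPred_eq, mem_empty_iff_false, iff_false, not_le]
      nlinarith [sq_nonneg ‖z‖]
    simp [this]

theorem setIntegral_closedBall_comp_fst {n : ℕ} (hn : n ≠ 0) {f : ℝ → ℝ} (hf : Continuous f)
    (c R : ℝ) (hR : 0 ≤ R) :
    ∫ x in Metric.closedBall (EuclideanSpace.single 0 c : Space (n + 1)) R, f (x 0) =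
      ∫ t, f t * sliceArea n R c t := by
  set B := Metric.closedBall (EuclideanSpace.single 0 c : Space (n + 1)) R
  set D : Set (ℝ × Space n) := {p | (p.1 - c) ^ 2 + ‖p.2‖ ^ 2 ≤ R ^ 2}
  have hBD : ∀ x, x ∈ B ↔ splitEquiv n x ∈ D := by
    intro x
    rw [Metric.mem_closedBall, dist_eq_norm, mem_ofPred_eq, splitEquiv_fst, ← norm_sub_single_sq,
      pow_le_pow_iff_left₀ (norm_nonneg _) hR two_ne_zero]
  have hD : MeasurableSet D :=
    (isClosed_le (by fun_prop) (by fun_prop)).measurableSet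
  have hcomp : ∀ x, B.indicator (fun x => f (x 0)) x =
      (D.indicator fun p => f p.1) (splitEquiv n x) := by
    intro x
    by_cases hx : x ∈ B
    · rw [indicator_of_mem hx, indicator_of_mem ((hBD x).1 hx), splitEquiv_fst]
    · rw [indicator_of_notMem hx, indicator_of_notMem (fun h => hx ((hBD x).2 h))]
  have hint : Integrable (D.indicator fun p => f p.1) (volume.prod volume) := by
    have h1 : Integrable (B.indicator fun x => f (x 0)) := by
      rw [integrable_indicator_iff measurableSet_closedBall]
      exact (Continuous.continuousOn (by fun_prop)).integrableOn_compact (isCompact_closedBall _ _)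
    rw [funext hcomp] at h1
    exact ((measurePreserving_splitEquiv n).integrable_comp_emb
      (splitEquiv n).measurableEmbedding).1 h1
  rw [← integral_indicator measurableSet_closedBall]
  rw [integral_congr_ae (Eventually.of_forall hcomp), (measurePreserving_splitEquiv n).integral_comp (splitEquiv n).measurableEmbedding
    (D.indicator fun p => f p.1)]
  refine (integral_prod _ hint).trans (integral_congr_ae (Eventually.of_forall fun t => ?_))
  have : ∀ z : Space n, (D.indicator fun p => f p.1) (t, z) =
      {z : Space n | (t - c) ^ 2 + ‖z‖ ^ 2 ≤ R ^ 2}.indicator (fun _ => f t) z := fun z => rfl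
  simp_rw [this]
  rw [integral_indicator_const _ (isClosed_le (by fun_prop) (by fun_prop)).measurableSet,
    volume_real_slice hn, smul_eq_mul, mul_comm]

/-! ### The derivative of a smooth step as an approximation of the Dirac mass -/

theorem hasCompactSupport_deriv_smoothStep {ε : ℝ} (hε : 0 < ε) :
    HasCompactSupport (deriv (smoothStep ε)) := by
  refine HasCompactSupport.intro (isCompact_Icc (a := ε) (b := 2 * ε)) fun t ht => ?_
  rw [mem_Icc, not_and_or, not_le, not_le] at ht
  exact ht.elim (deriv_smoothStep_of_lt hε) (deriv_smoothStep_of_gt hε)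

theorem integrable_deriv_smoothStep {ε : ℝ} (hε : 0 < ε) : Integrable (deriv (smoothStep ε)) :=
  (continuous_deriv_smoothStep ε).integrable_of_hasCompactSupport
    (hasCompactSupport_deriv_smoothStep hε)

theorem integral_deriv_smoothStep {ε : ℝ} (hε : 0 < ε) : ∫ t, deriv (smoothStep ε) t = 1 := by
  have h0 : Tendsto (smoothStep ε) atBot (𝓝 0) := by
    refine tendsto_const_nhds.congr' ?_
    filter_upwards [eventually_le_atBot ε] with t ht using (smoothStep_eq_zero hε ht).symm
  have h1 : Tendsto (smoothStep ε) atTop (𝓝 1) := by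
    refine tendsto_const_nhds.congr' ?_
    filter_upwards [eventually_ge_atTop (2 * ε)] with t ht using (smoothStep_eq_one hε ht).symm
  rw [integral_of_hasDerivAt_of_tendsto (hasDerivAt_smoothStep ε) (integrable_deriv_smoothStep hε)
    h0 h1, sub_zero]

/-- The derivative of the step is nonnegative, has integral one and lives on [ε, 2ε]. -/
theorem tendsto_integral_deriv_smoothStep_mul {g : ℝ → ℝ} (hg : Continuous g) :
    Tendsto (fun ε => ∫ t, deriv (smoothStep ε) t * g t) (𝓝[>] 0) (𝓝 (g 0)) := by
  rw [Metric.tendsto_nhds]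
  intro η hη
  obtain ⟨δ, hδ, hgδ⟩ := Metric.continuous_iff.1 hg 0 (η / 2) (half_pos hη)
  filter_upwards [Ioo_mem_nhdsGT (half_pos hδ)] with ε hε
  have hi := integrable_deriv_smoothStep hε.1
  have hig : Integrable fun t => deriv (smoothStep ε) t * g t :=
    ((continuous_deriv_smoothStep ε).mul hg).integrable_of_hasCompactSupport
      (hasCompactSupport_deriv_smoothStep hε.1).mul_right
  have h1 : (∫ t, deriv (smoothStep ε) t * g t) - g 0 =
      ∫ t, (deriv (smoothStep ε) t * g t - deriv (smoothStep ε) t * g 0) := by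
    rw [integral_sub hig (hi.mul_const _), integral_mul_const, integral_deriv_smoothStep hε.1,
      one_mul]
  rw [Real.dist_eq, h1, ← Real.norm_eq_abs]
  have h2 : ‖∫ t, (deriv (smoothStep ε) t * g t - deriv (smoothStep ε) t * g 0)‖ ≤
      ∫ t, deriv (smoothStep ε) t * (η / 2) := by
    refine norm_integral_le_of_norm_le (hi.mul_const _) (Eventually.of_forall fun t => ?_)
    rw [← mul_sub, norm_mul, Real.norm_eq_abs, abs_of_nonneg (deriv_smoothStep_nonneg hε.1 t)]
    rcases lt_or_ge t ε with h1 | h1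
    · simp [deriv_smoothStep_of_lt hε.1 h1]
    rcases lt_or_ge (2 * ε) t with h2 | h2
    · simp [deriv_smoothStep_of_gt hε.1 h2]
    refine mul_le_mul_of_nonneg_left ?_ (deriv_smoothStep_nonneg hε.1 t)
    rw [← dist_eq_norm]
    refine (hgδ t ?_).le
    rw [Real.dist_eq, sub_zero, abs_of_nonneg (hε.1.le.trans h1)]
    linarith [hε.2]
  rw [integral_mul_const, integral_deriv_smoothStep hε.1, one_mul] at h2
  linarith

theorem setIntegral_closedBall_comp_signed {n : ℕ} (hn : n ≠ 0) {σ : ℝ} (hσ : σ = 1 ∨ σ = -1)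
    {f : ℝ → ℝ} (hf : Continuous f) (c R : ℝ) (hR : 0 ≤ R) :
    ∫ x in Metric.closedBall (EuclideanSpace.single 0 (σ * c) : Space (n + 1)) R, f (σ * x 0) =
      ∫ t, f t * sliceArea n R c t := by
  rw [setIntegral_closedBall_comp_fst hn (f := fun t => f (σ * t)) (by fun_prop) _ _ hR]
  rcases hσ with rfl | rfl
  · simp
  · rw [← integral_neg_eq_self]
    refine integral_congr_ae (Eventually.of_forall fun t => ?_)
    simp only [sliceArea, neg_mul, one_mul, neg_neg]
    congr 4
    ring

/-- By Fubini the integral over the ball becomes one over heights weighted by the continuous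
`sliceArea`, and the mass concentrates on the disc in which the ball meets `Σ`. -/
theorem tendsto_integral_deriv_smoothStep_closedBall {n : ℕ} (hn : n ≠ 0) {σ : ℝ}
    (hσ : σ = 1 ∨ σ = -1) {g : ℝ → ℝ} (hg : Continuous g) (c R : ℝ) (hR : 0 ≤ R) :
    Tendsto (fun ε => ∫ x in Metric.closedBall (EuclideanSpace.single 0 (σ * c) : Space (n + 1)) R,
      deriv (smoothStep ε) (σ * x 0) * g (σ * x 0)) (𝓝[>] 0) (𝓝 (g 0 * sliceArea n R c 0)) := by
  refine (tendsto_integral_deriv_smoothStep_mul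
    (hg.mul (continuous_sliceArea n R c))).congr fun ε => ?_
  have hc := continuous_deriv_smoothStep ε
  rw [setIntegral_closedBall_comp_signed hn hσ
    (f := fun t => deriv (smoothStep ε) t * g t) (by fun_prop) c R hR]
  simp [mul_assoc]

/-! ### Diagonal maps -/

/-- The linear map with diagonal matrix `d`. -/
def diagMap {N : ℕ} (d : Fin N → ℝ) : Space N →L[ℝ] Space N :=
  LinearMap.toContinuousLinearMap
    { toFun := fun x => WithLp.toLp 2 fun i => d i * x i
      map_add' := fun x y => by ext i; simp [mul_add]
      map_smul' := fun r x => by ext i; simp [mul_left_comm] }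

@[simp] theorem diagMap_apply {N : ℕ} (d : Fin N → ℝ) (x : Space N) (i : Fin N) :
    diagMap d x i = d i * x i := rfl

theorem sum_diagMap_single {N : ℕ} (d : Fin N → ℝ) :
    ∑ i, diagMap d (EuclideanSpace.single i 1) i = ∑ i, d i := by
  simp

theorem inner_diagMap {N : ℕ} (d : Fin N → ℝ) (x : Space N) :
    inner ℝ x (diagMap d x) = ∑ i, d i * x i ^ 2 := by
  rw [PiLp.inner_apply]
  refine Finset.sum_congr rfl fun i _ => ?_
  simp; ring

theorem det_diagMap {N : ℕ} (d : Fin N → ℝ) :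
    LinearMap.det (diagMap d : Space N →ₗ[ℝ] Space N) = ∏ i, d i := by
  rw [← LinearMap.det_toMatrix (EuclideanSpace.basisFun (Fin N) ℝ).toBasis, ← Matrix.det_diagonal]
  congr 1
  ext i j
  by_cases h : i = j <;> simp [LinearMap.toMatrix_apply, h]

theorem measurePreserving_diagMap {N : ℕ} {d : Fin N → ℝ} (hd : ∏ i, d i = 1) :
    MeasurePreserving (diagMap d) := by
  refine ⟨(diagMap d).continuous.measurable, ?_⟩
  have := Measure.map_linearMap_addHaar_eq_smul_addHaar (volume : Measure (Space N))
    (f := (diagMap d : Space N →ₗ[ℝ] Space N)) (by rw [det_diagMap, hd]; exact one_ne_zero)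
  rw [det_diagMap, hd] at this
  simpa using this

theorem diagMap_diagMap_inv {N : ℕ} {d : Fin N → ℝ} (hd : ∀ i, d i ≠ 0) (x : Space N) :
    diagMap d (diagMap d⁻¹ x) = x := by
  ext i
  simp [hd i]

/-- A diagonal change of variables on vector fields. -/
def pullField {N : ℕ} (d : Fin N → ℝ) (T : Space N → Space N) (x : Space N) : Space N :=
  diagMap d⁻¹ (T (diagMap d x))

theorem contDiff_pullField {N : ℕ} (d : Fin N → ℝ) {T : Space N → Space N} (hT : ContDiff ℝ 1 T) :
    ContDiff ℝ 1 (pullField d T) :=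
  (diagMap d⁻¹).contDiff.comp (hT.comp (diagMap d).contDiff)

/-- The derivative is conjugated by the diagonal matrix, which leaves its trace unchanged. -/
theorem divergence_pullField {N : ℕ} {d : Fin N → ℝ} (hd : ∀ i, d i ≠ 0)
    {T : Space N → Space N} (hT : Differentiable ℝ T) (x : Space N) :
    divergence (pullField d T) x = divergence T (diagMap d x) := by
  have h : HasFDerivAt (pullField d T)
      ((diagMap d⁻¹).comp ((fderiv ℝ T (diagMap d x)).comp (diagMap d))) x :=
    (diagMap d⁻¹).hasFDerivAt.comp x ((hT _).hasFDerivAt.comp x (diagMap d).hasFDerivAt)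
  simp only [divergence, h.fderiv]
  refine Finset.sum_congr rfl fun i _ => ?_
  have : diagMap d (EuclideanSpace.single i 1) = d i • EuclideanSpace.single i (1 : ℝ) := by
    ext j
    by_cases hj : j = i
    · subst hj; simp
    · simp [hj]
  simp [this, hd i]

theorem inner_pullField_le {N : ℕ} (d : Fin N → ℝ) {T : Space N → Space N}
    (hT : ∀ x, ‖T x‖ ≤ 1) (x y : Space N) : inner ℝ y (pullField d T x) ≤ ‖diagMap d⁻¹ y‖ := by
  have h : inner ℝ y (pullField d T x) = inner ℝ (diagMap d⁻¹ y) (T (diagMap d x)) := by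
    rw [PiLp.inner_apply, PiLp.inner_apply]
    refine Finset.sum_congr rfl fun i _ => ?_
    simp [pullField]; ring
  rw [h]
  exact (real_inner_le_norm _ _).trans (mul_le_of_le_one_right (norm_nonneg _) (hT _))

/-! ### Integration over the part of a ball on one side of the hyperplane -/

/-- The open half-space `{0 < σ x₁}`. -/
def side (n : ℕ) (σ : ℝ) : Set (Space (n + 1)) := {x | 0 < σ * x 0}

/-- The closed ball of radius `R` centred at height `R κ` over the boundary of `side n σ`. -/
def capBall (n : ℕ) (σ κ R : ℝ) : Set (Space (n + 1)) :=
  Metric.closedBall (EuclideanSpace.single 0 (σ * (R * κ))) R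

theorem measurableSet_side (n : ℕ) (σ : ℝ) : MeasurableSet (side n σ) :=
  (isOpen_lt continuous_const (by fun_prop)).measurableSet

theorem contDiff_smoothStep_height (n : ℕ) (σ ε : ℝ) :
    ContDiff ℝ 1 fun x : Space (n + 1) => smoothStep ε (σ * x 0) := by
  have h := contDiff_smoothStep ε
  have h2 : ContDiff ℝ 1 fun x : Space (n + 1) => σ * x 0 :=
    contDiff_const.mul (EuclideanSpace.proj (𝕜 := ℝ) (0 : Fin (n + 1))).contDiff
  exact h.comp h2

theorem contDiff_smoothStep_smul {n : ℕ} (σ ε : ℝ) {S : Space (n + 1) → Space (n + 1)}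
    (hS : ContDiff ℝ 1 S) : ContDiff ℝ 1 fun y => smoothStep ε (σ * y 0) • S y :=
  (contDiff_smoothStep_height n σ ε).smul hS

theorem fderiv_smoothStep_height (n : ℕ) (σ ε : ℝ) (x v : Space (n + 1)) :
    fderiv ℝ (fun x : Space (n + 1) => smoothStep ε (σ * x 0)) x v =
      deriv (smoothStep ε) (σ * x 0) * (σ * v 0) := by
  have h1 : HasFDerivAt (fun x : Space (n + 1) => σ * x 0)
      (σ • (EuclideanSpace.proj (𝕜 := ℝ) (0 : Fin (n + 1)))) x :=
    ((EuclideanSpace.proj (𝕜 := ℝ) (0 : Fin (n + 1))).hasFDerivAt).const_mul σ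
  have h2 : HasFDerivAt (fun x : Space (n + 1) => smoothStep ε (σ * x 0)) _ x :=
    HasDerivAt.comp_hasFDerivAt (h₂ := smoothStep ε) x (hasDerivAt_smoothStep ε (σ * x 0)) h1
  rw [h2.fderiv]
  simp

theorem divergence_smoothStep_smul {n : ℕ} (σ ε : ℝ) {S : Space (n + 1) → Space (n + 1)}
    (hS : ContDiff ℝ 1 S) (x : Space (n + 1)) :
    divergence (fun y => smoothStep ε (σ * y 0) • S y) x =
      smoothStep ε (σ * x 0) * divergence S x +
        deriv (smoothStep ε) (σ * x 0) * (σ * S x 0) := by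
  rw [divergence_smul ((contDiff_smoothStep_height n σ ε).differentiable one_ne_zero x)
    (hS.differentiable one_ne_zero x), fderiv_smoothStep_height]

theorem tendsto_integral_smoothStep_mul {n : ℕ} (σ κ R : ℝ) {f : Space (n + 1) → ℝ}
    (hf : Continuous f) :
    Tendsto (fun ε => ∫ x in capBall n σ κ R, smoothStep ε (σ * x 0) * f x) (𝓝[>] 0)
      (𝓝 (∫ x in capBall n σ κ R ∩ side n σ, f x)) := by
  rw [← setIntegral_indicator (measurableSet_side n σ)]
  refine tendsto_integral_filter_of_dominated_convergence (fun x => |f x|) ?_ ?_ ?_ ?_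
  · exact Eventually.of_forall fun ε =>
      ((contDiff_smoothStep_height n σ ε).continuous.mul hf).aestronglyMeasurable
  · refine Eventually.of_forall fun ε => Eventually.of_forall fun x => ?_
    rw [Real.norm_eq_abs, abs_mul, abs_of_nonneg (smoothStep_nonneg ..)]
    exact mul_le_of_le_one_left (abs_nonneg _) (smoothStep_le_one ..)
  · exact hf.abs.continuousOn.integrableOn_compact (isCompact_closedBall _ _)
  · refine Eventually.of_forall fun x => ?_
    refine ((tendsto_smoothStep (σ * x 0)).mul_const (f x)).trans_eq ?_
    congr 1
    by_cases hx : x ∈ side n σ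
    · rw [indicator_of_mem hx, if_pos (show 0 < σ * x 0 from hx), one_mul]
    · rw [indicator_of_notMem hx, if_neg (show ¬0 < σ * x 0 from hx), zero_mul]

/-- The flux of the linear field `x ↦ diag(d) (x - c)` through the cap which the sphere with centre
`c = (σ R κ, 0)` and radius `R` has in `side n σ`. -/
def capFlux (n : ℕ) (σ κ R : ℝ) (d : Fin (n + 1) → ℝ) : ℝ :=
  (∑ i, d i) * volume.real (capBall n σ κ R ∩ side n σ) -
    d 0 * (R * κ) * sliceArea n R (R * κ) 0

/-- Divergence theorem on the ball cut by the half-space: the step contributes the trace on one side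
of `Σ`, its derivative the flux through the disc, where the first component of the field relative to
`σ` is -d₀Rκ. -/
theorem tendsto_integral_divergence_diagMap {n : ℕ} (hn : n ≠ 0) {σ : ℝ} (hσ : σ = 1 ∨ σ = -1)
    (κ : ℝ) {R : ℝ} (hR : 0 ≤ R) (d : Fin (n + 1) → ℝ) :
    Tendsto (fun ε => ∫ x in capBall n σ κ R, divergence (fun y => smoothStep ε (σ * y 0) •
        diagMap d (y - EuclideanSpace.single 0 (σ * (R * κ)))) x) (𝓝[>] 0)
      (𝓝 (capFlux n σ κ R d)) := by
  have hW : ContDiff ℝ 1 fun y : Space (n + 1) =>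
      diagMap d (y - EuclideanSpace.single 0 (σ * (R * κ))) :=
    (diagMap d).contDiff.comp (contDiff_id.sub contDiff_const)
  have hdiv : ∀ ε x, divergence (fun y => smoothStep ε (σ * y 0) •
        diagMap d (y - EuclideanSpace.single 0 (σ * (R * κ)))) x =
      smoothStep ε (σ * x 0) * (∑ i, d i) +
        deriv (smoothStep ε) (σ * x 0) * (d 0 * (σ * x 0 - R * κ)) := by
    intro ε x
    rw [divergence_smoothStep_smul σ ε hW, divergence_clm_sub, sum_diagMap_single]
    have hσ2 : σ * σ = 1 := by rcases hσ with rfl | rfl <;> norm_num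
    simp only [diagMap_apply, PiLp.sub_apply, PiLp.single_apply, if_true]
    linear_combination (-deriv (smoothStep ε) (σ * x 0) * d 0 * R * κ) * hσ2
  have h1 := tendsto_integral_smoothStep_mul (n := n) σ κ R (f := fun _ => ∑ i, d i)
    continuous_const
  have h2 := tendsto_integral_deriv_smoothStep_closedBall hn hσ
    (g := fun t => d 0 * (t - R * κ)) (by fun_prop) (R * κ) R hR
  refine ((h1.add h2).congr fun ε => ?_).trans_eq ?_
  · have hs := (contDiff_smoothStep_height n σ ε).continuous
    have hs' := continuous_deriv_smoothStep ε
    simp_rw [hdiv]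
    rw [integral_add]
    · rfl
    · exact (hs.mul continuous_const).continuousOn.integrableOn_compact (isCompact_closedBall _ _)
    · exact (Continuous.continuousOn (by fun_prop)).integrableOn_compact (isCompact_closedBall _ _)
  · rw [capFlux, setIntegral_const, smul_eq_mul]
    congr 1
    ring

theorem inner_smoothStep_smul_le {n : ℕ} {σ ε : ℝ} {S T : Space (n + 1)} {x y : Space (n + 1)}
    (h : inner ℝ y S ≤ inner ℝ y T) :
    inner ℝ y (smoothStep ε (σ * x 0) • S) ≤ inner ℝ y (smoothStep ε (σ * x 0) • T) := by
  rw [inner_smul_right, inner_smul_right]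
  exact mul_le_mul_of_nonneg_left h (smoothStep_nonneg _ _)

/-- Comparison with the zero field, since a nonnegative diagonal field points outwards along the
sphere. Nonnegativity is needed later because `ENNReal.ofReal` truncates. -/
theorem capFlux_nonneg {n : ℕ} (hn : n ≠ 0) {σ : ℝ} (hσ : σ = 1 ∨ σ = -1)
    (κ : ℝ) {R : ℝ} (hR : 0 < R) {d : Fin (n + 1) → ℝ} (hd : ∀ i, 0 ≤ d i) :
    0 ≤ capFlux n σ κ R d := by
  refine ge_of_tendsto' (tendsto_integral_divergence_diagMap hn hσ κ hR.le d) fun ε => ?_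
  have hW : ContDiff ℝ 1 fun y : Space (n + 1) =>
      diagMap d (y - EuclideanSpace.single 0 (σ * (R * κ))) :=
    (diagMap d).contDiff.comp (contDiff_id.sub contDiff_const)
  have := integral_divergence_closedBall_mono
    (S := fun _ : Space (n + 1) => 0) contDiff_const
    (contDiff_smoothStep_smul σ ε hW) (c := EuclideanSpace.single 0 (σ * (R * κ))) hR
    (fun x _ => by
      rw [inner_smul_right, inner_diagMap, inner_zero_right]
      exact mul_nonneg (smoothStep_nonneg _ _)
        (Finset.sum_nonneg fun i _ => mul_nonneg (hd i) (sq_nonneg _)))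
  refine le_trans (le_of_eq ?_) this
  simp [divergence]

/-- The comparison on the sphere applies to both fields multiplied by the half-space step. The
derivative of the step leaves a flux of `S` through the disc, at most C times its area. The constant
is 0 for fields supported off `Σ` and 1 for arbitrary test fields. -/
theorem setIntegral_divergence_le_capFlux {n : ℕ} (hn : n ≠ 0) {σ : ℝ} (hσ : σ = 1 ∨ σ = -1)
    (κ : ℝ) {R : ℝ} (hR : 0 < R) (d : Fin (n + 1) → ℝ) {S : Space (n + 1) → Space (n + 1)}
    (hS : ContDiff ℝ 1 S)
    (h : ∀ x ∈ Metric.sphere (EuclideanSpace.single 0 (σ * (R * κ)) : Space (n + 1)) R,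
      inner ℝ (x - EuclideanSpace.single 0 (σ * (R * κ))) (S x) ≤
        inner ℝ (x - EuclideanSpace.single 0 (σ * (R * κ)))
          (diagMap d (x - EuclideanSpace.single 0 (σ * (R * κ)))))
    {C δ : ℝ} (hδ : 0 < δ) (hC : ∀ x, 0 < σ * x 0 → σ * x 0 ≤ δ → |S x 0| ≤ C) :
    ∫ x in capBall n σ κ R ∩ side n σ, divergence S x ≤
      capFlux n σ κ R d + C * sliceArea n R (R * κ) 0 := by
  have hW : ContDiff ℝ 1 fun y : Space (n + 1) =>
      diagMap d (y - EuclideanSpace.single 0 (σ * (R * κ))) :=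
    (diagMap d).contDiff.comp (contDiff_id.sub contDiff_const)
  have h1 := tendsto_integral_smoothStep_mul σ κ R (continuous_divergence hS)
  have h2 := tendsto_integral_divergence_diagMap hn hσ κ hR.le d
  have h3 := tendsto_integral_deriv_smoothStep_closedBall hn hσ
    (g := fun _ => C) continuous_const (R * κ) R hR.le
  refine le_of_tendsto_of_tendsto h1 (h2.add h3) ?_
  filter_upwards [Ioo_mem_nhdsGT (half_pos hδ)] with ε hε
  have hs := (contDiff_smoothStep_height n σ ε).continuous
  have hs' := continuous_deriv_smoothStep ε
  have hdS := continuous_divergence hS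
  have hS0 : Continuous fun x => S x 0 := by have := hS.continuous; fun_prop
  have hmono := integral_divergence_closedBall_mono
    (contDiff_smoothStep_smul σ ε hS) (contDiff_smoothStep_smul σ ε hW)
    (c := EuclideanSpace.single 0 (σ * (R * κ))) hR
    (fun x hx => inner_smoothStep_smul_le (h x hx))
  have hB : IsCompact (capBall n σ κ R) := isCompact_closedBall _ _
  have hi1 : IntegrableOn (fun x => smoothStep ε (σ * x 0) * divergence S x) (capBall n σ κ R) :=
    (hs.mul hdS).continuousOn.integrableOn_compact hB
  have hi2 : IntegrableOn (fun x : Space (n + 1) => deriv (smoothStep ε) (σ * x 0) * (σ * S x 0))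
      (capBall n σ κ R) :=
    (Continuous.continuousOn (by fun_prop)).integrableOn_compact hB
  have hi3 : IntegrableOn (fun x : Space (n + 1) => deriv (smoothStep ε) (σ * x 0) * C)
      (capBall n σ κ R) :=
    (Continuous.continuousOn (by fun_prop)).integrableOn_compact hB
  have hsplit : ∫ x in capBall n σ κ R, divergence (fun y => smoothStep ε (σ * y 0) • S y) x =
      (∫ x in capBall n σ κ R, smoothStep ε (σ * x 0) * divergence S x) +
        ∫ x in capBall n σ κ R, deriv (smoothStep ε) (σ * x 0) * (σ * S x 0) := by
    simp_rw [divergence_smoothStep_smul σ ε hS]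
    exact integral_add hi1 hi2
  -- The derivative of the step is carried by ε ≤ σx₁ ≤ 2ε < δ, where the bound by `C` is available.
  have hbd : -∫ x in capBall n σ κ R, deriv (smoothStep ε) (σ * x 0) * (σ * S x 0) ≤
      ∫ x in capBall n σ κ R, deriv (smoothStep ε) (σ * x 0) * C := by
    rw [← integral_neg]
    refine integral_mono hi2.neg hi3 fun x => ?_
    change -(_ * _) ≤ _
    rw [← mul_neg]
    rcases lt_or_ge (σ * x 0) ε with hlt | hge
    · simp [deriv_smoothStep_of_lt hε.1 hlt]
    rcases lt_or_ge (2 * ε) (σ * x 0) with hgt | hle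
    · simp [deriv_smoothStep_of_gt hε.1 hgt]
    refine mul_le_mul_of_nonneg_left ?_ (deriv_smoothStep_nonneg hε.1 _)
    have hb := hC x (hε.1.trans_le hge) (by linarith [hε.2])
    rcases hσ with rfl | rfl
    · linarith [neg_abs_le (S x 0)]
    · linarith [le_abs_self (S x 0)]
  change _ ≤ (∫ x in capBall n σ κ R, _) + ∫ x in capBall n σ κ R, _
  change (∫ x in capBall n σ κ R, divergence (fun y => smoothStep ε (σ * y 0) • S y) x) ≤
    ∫ x in capBall n σ κ R, _ at hmono
  rw [hsplit] at hmono
  linarith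

/-! ### Perimeters of diagonally deformed caps -/

/-- The diagonal of a linear field whose flux bounds the area of the deformed cap. -/
def fluxWeight {N : ℕ} (R : ℝ) (d : Fin N → ℝ) (i : Fin N) : ℝ := (1 + (d i)⁻¹ ^ 2) / (2 * R)

/-- The inequality 2R|D⁻¹y| ≤ R² + |D⁻¹y|² with R² = |y|²: the norm is dominated by a quadratic
form, with equality when D is the identity. -/
theorem norm_diagMap_inv_le {N : ℕ} {R : ℝ} (hR : 0 < R) (d : Fin N → ℝ) {y : Space N}
    (hy : ‖y‖ = R) : ‖diagMap d⁻¹ y‖ ≤ inner ℝ y (diagMap (fluxWeight R d) y) := by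
  have h : inner ℝ y (diagMap (fluxWeight R d) y) = (‖y‖ ^ 2 + ‖diagMap d⁻¹ y‖ ^ 2) / (2 * R) := by
    rw [inner_diagMap, EuclideanSpace.real_norm_sq_eq, EuclideanSpace.real_norm_sq_eq,
      ← Finset.sum_add_distrib, Finset.sum_div]
    refine Finset.sum_congr rfl fun i _ => ?_
    simp only [fluxWeight, diagMap_apply, Pi.inv_apply]
    ring
  rw [h, hy, le_div_iff₀ (by positivity)]
  nlinarith [sq_nonneg (R - ‖diagMap d⁻¹ y‖)]

theorem preimage_inter_side {n : ℕ} {d : Fin (n + 1) → ℝ} (hd : ∀ i, 0 < d i) (σ : ℝ)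
    (B : Set (Space (n + 1))) :
    diagMap d⁻¹ ⁻¹' B ∩ side n σ = diagMap d⁻¹ ⁻¹' (B ∩ side n σ) := by
  rw [preimage_inter]
  congr 1
  ext x
  have : σ * (diagMap d⁻¹ x) 0 = (d 0)⁻¹ * (σ * x 0) := by simp; ring
  simp only [side, mem_ofPred_eq, mem_preimage, this]
  exact (mul_pos_iff_of_pos_left (inv_pos.2 (hd 0))).symm

/-- The volume-preserving change of variables moves the integral to the undeformed ball and replaces
`T` by `pullField d T`, with the same divergence. -/
theorem setIntegral_divergence_deformed_cap_le {n : ℕ} (hn : n ≠ 0) {σ : ℝ}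
    (hσ : σ = 1 ∨ σ = -1) (κ : ℝ) {R : ℝ} (hR : 0 < R) {d : Fin (n + 1) → ℝ} (hd : ∀ i, 0 < d i)
    (hdet : ∏ i, d i = 1) {D : Set (Space (n + 1))}
    (hD : D ∩ side n σ = diagMap d⁻¹ ⁻¹' capBall n σ κ R ∩ side n σ)
    {T : Space (n + 1) → Space (n + 1)} (hT : ContDiff ℝ 1 T) (hT1 : ∀ x, ‖T x‖ ≤ 1)
    {C δ : ℝ} (hδ : 0 < δ) (hC : ∀ x, 0 < σ * x 0 → σ * x 0 ≤ δ → |T x 0| ≤ C) :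
    ∫ x in D ∩ side n σ, divergence T x ≤
      capFlux n σ κ R (fluxWeight R d) + (d 0)⁻¹ * C * sliceArea n R (R * κ) 0 := by
  have hd0 : ∀ i, d i ≠ 0 := fun i => (hd i).ne'
  have hside := hD.trans (preimage_inter_side hd σ (capBall n σ κ R))
  have hmp : MeasurePreserving (diagMap d⁻¹) :=
    measurePreserving_diagMap (by simp [hdet])
  have hemb : MeasurableEmbedding (diagMap d⁻¹) :=
    (diagMap d⁻¹).continuous.measurableEmbedding fun x y hxy => by
      rw [← diagMap_diagMap_inv hd0 x, hxy, diagMap_diagMap_inv hd0]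
  have hcv := hmp.setIntegral_preimage_emb hemb (fun x => divergence T (diagMap d x))
    (capBall n σ κ R ∩ side n σ)
  simp only [diagMap_diagMap_inv hd0] at hcv
  rw [hside, hcv]
  simp_rw [← divergence_pullField hd0 (hT.differentiable one_ne_zero)]
  refine setIntegral_divergence_le_capFlux hn hσ κ hR _ (contDiff_pullField d hT)
    (δ := (d 0)⁻¹ * δ) ?_ (mul_pos (inv_pos.2 (hd 0)) hδ) ?_
  · intro x hx
    exact (inner_pullField_le d hT1 x _).trans (norm_diagMap_inv_le hR d (by simpa using hx))
  · intro x h1 h2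
    have hx : σ * (diagMap d x) 0 = d 0 * (σ * x 0) := by simp; ring
    have hb := hC (diagMap d x) (by rw [hx]; exact mul_pos (hd 0) h1)
      (by rw [hx]; exact (le_inv_mul_iff₀ (hd 0)).1 h2)
    rw [pullField, diagMap_apply, Pi.inv_apply, abs_mul, abs_of_pos (inv_pos.2 (hd 0))]
    exact mul_le_mul_of_nonneg_left hb (inv_pos.2 (hd 0)).le

theorem setIntegral_divergence_inter_of_tsupport_subset {N : ℕ} {A D : Set (Space N)}
    (hA : MeasurableSet A) {T : Space N → Space N} (hT : tsupport T ⊆ A) :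
    ∫ x in D, divergence T x = ∫ x in D ∩ A, divergence T x := by
  rw [← setIntegral_indicator hA]
  congr 1
  ext x
  by_cases hx : x ∈ A
  · rw [indicator_of_mem hx]
  · rw [indicator_of_notMem hx, divergence_eq_zero_of_notMem_tsupport fun h => hx (hT h)]

theorem perimeter_deformed_cap_le {n : ℕ} (hn : n ≠ 0) {σ : ℝ}
    (hσ : σ = 1 ∨ σ = -1) (κ : ℝ) {R : ℝ} (hR : 0 < R) {d : Fin (n + 1) → ℝ} (hd : ∀ i, 0 < d i)
    (hdet : ∏ i, d i = 1) {D : Set (Space (n + 1))}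
    (hD : D ∩ side n σ = diagMap d⁻¹ ⁻¹' capBall n σ κ R ∩ side n σ) :
    perimeter D (side n σ) ≤ ENNReal.ofReal (capFlux n σ κ R (fluxWeight R d)) := by
  refine iSup₂_le fun T hT => ENNReal.ofReal_le_ofReal ?_
  rw [setIntegral_divergence_inter_of_tsupport_subset (measurableSet_side n σ) hT.tsupport_subset]
  -- The support is compact in the open half-space, so it stays at height at least δ and the field
  -- vanishes up to height δ/2: no flux crosses the disc.
  obtain ⟨δ, hδ, hδT⟩ := hT.hasCompactSupport.isCompact.exists_forall_le'
    (f := fun x : Space (n + 1) => σ * x 0) (by fun_prop) (a := 0) fun x hx => hT.tsupport_subset hx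
  have := setIntegral_divergence_deformed_cap_le hn hσ κ hR hd hdet hD hT.contDiff hT.norm_le_one
    (C := 0) (half_pos hδ) fun x _ h2 => by
      have hx : x ∉ tsupport T := fun h => by linarith [hδT x h]
      simp [image_eq_zero_of_notMem_tsupport hx]
  simpa using this

/-- The test field is r(y - c), normal to the sphere, times two cutoffs: the step keeps its support
off `Σ`, and the ball cutoff gives compact support without changing it near the ball. The condition
on r bounds its norm by one wherever the ball cutoff is nonzero. -/
theorem ofReal_capFlux_const_le_perimeter {n : ℕ} (hn : n ≠ 0) {σ : ℝ} (hσ : σ = 1 ∨ σ = -1)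
    (κ : ℝ) {R : ℝ} (hR : 0 < R) {D : Set (Space (n + 1))}
    (hD : D ∩ side n σ = capBall n σ κ R ∩ side n σ) {δ r : ℝ} (hδ : 0 < δ)
    (hrδ : r ^ 2 * (R ^ 2 + 2 * δ) ≤ 1) :
    ENNReal.ofReal (capFlux n σ κ R fun _ => r) ≤ perimeter D (side n σ) := by
  set c : Space (n + 1) := EuclideanSpace.single 0 (σ * (R * κ)) with hc
  refine le_of_tendsto ((ENNReal.continuous_ofReal.tendsto _).comp
    (tendsto_integral_divergence_diagMap hn hσ κ hR.le fun _ => r)) ?_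
  filter_upwards [self_mem_nhdsWithin] with ε hε
  replace hε : 0 < ε := hε
  have hW : ContDiff ℝ 1 fun y : Space (n + 1) => diagMap (fun _ => r) (y - c) :=
    (diagMap _).contDiff.comp (contDiff_id.sub contDiff_const)
  have hdiag : ∀ y : Space (n + 1), diagMap (fun _ => r) y = r • y := fun y => by ext i; simp
  set X : Space (n + 1) → Space (n + 1) := fun y => smoothStep ε (σ * y 0) • diagMap (fun _ => r) (y - c)
  set T : Space (n + 1) → Space (n + 1) := fun y => ballCutoff c R δ y • X y
  have hsub : tsupport T ⊆ {x | ε ≤ σ * x 0} := by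
    refine closure_minimal (fun x hx => ?_) (isClosed_le continuous_const (by fun_prop))
    by_contra h
    rw [mem_ofPred_eq, not_le] at h
    exact hx (by simp [T, X, smoothStep_eq_zero hε h.le])
  have hsubA : tsupport T ⊆ side n σ := hsub.trans fun x hx => hε.trans_le hx
  have hT : IsTestField (side n σ) T := by
    refine ⟨(contDiff_ballCutoff c R δ).smul (contDiff_smoothStep_smul σ ε hW),
      (hasCompactSupport_ballCutoff c R hδ).smul_right, hsubA, fun x => ?_⟩
    rcases le_or_gt (R ^ 2 + 2 * δ) (‖x - c‖ ^ 2) with h | h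
    · simp [T, ballCutoff_eq_zero hδ h]
    · have h1 : ‖r • (x - c)‖ ≤ 1 := by
        rw [← sq_le_one_iff₀ (norm_nonneg _), norm_smul, mul_pow, Real.norm_eq_abs, sq_abs]
        exact (mul_le_mul_of_nonneg_left h.le (sq_nonneg r)).trans hrδ
      simp only [T, X, hdiag, norm_smul _ (r • (x - c)), norm_smul (ballCutoff c R δ x),
        Real.norm_eq_abs]
      rw [abs_of_nonneg (ballCutoff_nonneg ..), abs_of_nonneg (smoothStep_nonneg ..)]
      exact mul_le_one₀ (ballCutoff_le_one ..) (by positivity [smoothStep_nonneg ε (σ * x 0)])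
        (mul_le_one₀ (smoothStep_le_one ..) (norm_nonneg _) h1)
  refine le_trans (le_of_eq ?_) (le_iSup₂ (f := fun T _ => ENNReal.ofReal (∫ x in D, divergence T x)) T hT)
  change ENNReal.ofReal _ = ENNReal.ofReal _
  congr 1
  rw [setIntegral_divergence_inter_of_tsupport_subset (measurableSet_side n σ) hsubA, hD,
    ← setIntegral_divergence_inter_of_tsupport_subset (measurableSet_side n σ) hsubA]
  refine setIntegral_congr_fun measurableSet_closedBall fun x hx => ?_
  refine divergence_congr ?_
  have hopen : IsOpen {y : Space (n + 1) | ‖y - c‖ ^ 2 < R ^ 2 + δ} :=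
    isOpen_lt (by fun_prop) continuous_const
  have hxm : ‖x - c‖ ^ 2 < R ^ 2 + δ := by
    rw [capBall, Metric.mem_closedBall, dist_eq_norm] at hx
    have := pow_le_pow_left₀ (norm_nonneg _) hx 2
    linarith
  filter_upwards [hopen.mem_nhds hxm] with y hy
  simp only [T, X]
  rw [ballCutoff_eq_one hδ (le_of_lt hy), one_smul]

/-- Letting δ → 0 gives r = 1/R, the weight of `fluxWeight` for the identity, so the upper bound is
sharp for the undeformed cap. -/
theorem ofReal_capFlux_le_perimeter {n : ℕ} (hn : n ≠ 0) {σ : ℝ} (hσ : σ = 1 ∨ σ = -1)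
    (κ : ℝ) {R : ℝ} (hR : 0 < R) {D : Set (Space (n + 1))}
    (hD : D ∩ side n σ = capBall n σ κ R ∩ side n σ) :
    ENNReal.ofReal (capFlux n σ κ R (fluxWeight R 1)) ≤ perimeter D (side n σ) := by
  have h1 : fluxWeight R (1 : Fin (n + 1) → ℝ) = fun _ => R⁻¹ := by
    ext i
    simp only [fluxWeight, Pi.one_apply]
    field_simp
    norm_num
  rw [h1]
  have hlim : Tendsto (fun δ : ℝ => ENNReal.ofReal
      (capFlux n σ κ R fun _ => (Real.sqrt (R ^ 2 + 2 * δ))⁻¹)) (𝓝[>] 0)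
      (𝓝 (ENNReal.ofReal (capFlux n σ κ R fun _ => R⁻¹))) := by
    refine (ENNReal.continuous_ofReal.tendsto _).comp ?_
    have hr : Tendsto (fun δ : ℝ => (Real.sqrt (R ^ 2 + 2 * δ))⁻¹) (𝓝[>] 0) (𝓝 R⁻¹) := by
      have hc : ContinuousAt (fun δ : ℝ => (Real.sqrt (R ^ 2 + 2 * δ))⁻¹) 0 := by
        refine ContinuousAt.inv₀ (by fun_prop) ?_
        simp [Real.sqrt_sq hR.le, hR.ne']
      have := hc.tendsto
      simp only [mul_zero, add_zero, Real.sqrt_sq hR.le] at this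
      exact this.mono_left nhdsWithin_le_nhds
    simp only [capFlux, Finset.sum_const]
    exact ((hr.const_smul _).mul_const _).sub ((hr.mul_const _).mul_const _)
  refine le_of_tendsto hlim ?_
  filter_upwards [self_mem_nhdsWithin] with δ hδ
  replace hδ : 0 < δ := hδ
  refine ofReal_capFlux_const_le_perimeter hn hσ κ hR hD hδ ?_
  rw [inv_pow, Real.sq_sqrt (by positivity), inv_mul_cancel₀ (by positivity)]

theorem volume_height_eq_zero (n : ℕ) : volume {x : Space (n + 1) | x 0 = 0} = 0 := by
  have : {x : Space (n + 1) | x 0 = 0} = splitEquiv n ⁻¹' ({0} ×ˢ univ) := by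
    ext x; simp [splitEquiv_fst]
  rw [this, (measurePreserving_splitEquiv n).measure_preimage_equiv]
  change (volume.prod volume) _ = _
  rw [Measure.prod_prod]
  simp

/-- Test fields on the whole space need not vanish on `Σ`; each side then costs an extra flux
through its disc, bounded because |T| ≤ 1. -/
theorem perimeter_univ_lt_top {n : ℕ} (hn : n ≠ 0) {D : Set (Space (n + 1))}
    {κ R : ℝ} (hR : 0 < R) {d : Fin (n + 1) → ℝ} (hd : ∀ i, 0 < d i) (hdet : ∏ i, d i = 1)
    (hD : D ∩ side n 1 = diagMap d⁻¹ ⁻¹' capBall n 1 κ R ∩ side n 1)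
    {κ' R' : ℝ} (hR' : 0 < R') {d' : Fin (n + 1) → ℝ} (hd' : ∀ i, 0 < d' i)
    (hdet' : ∏ i, d' i = 1)
    (hD' : D ∩ side n (-1) = diagMap d'⁻¹ ⁻¹' capBall n (-1) κ' R' ∩ side n (-1)) :
    perimeter D univ < ∞ := by
  refine lt_of_le_of_lt (iSup₂_le fun T hT => ENNReal.ofReal_le_ofReal ?_)
    (ENNReal.ofReal_lt_top (r :=
      (capFlux n 1 κ R (fluxWeight R d) + (d 0)⁻¹ * 1 * sliceArea n R (R * κ) 0) +
      (capFlux n (-1) κ' R' (fluxWeight R' d') + (d' 0)⁻¹ * 1 * sliceArea n R' (R' * κ') 0)))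
  have hC : ∀ x : Space (n + 1), |T x 0| ≤ 1 := fun x => by
    have h1 := PiLp.norm_apply_le (T x) 0
    exact h1.trans (hT.norm_le_one x)
  have h1 := setIntegral_divergence_deformed_cap_le hn (Or.inl rfl) κ hR hd hdet hD hT.contDiff
    hT.norm_le_one one_pos fun x _ _ => hC x
  have h2 := setIntegral_divergence_deformed_cap_le hn (Or.inr rfl) κ' hR' hd' hdet' hD'
    hT.contDiff hT.norm_le_one one_pos fun x _ _ => hC x
  have hint : IntegrableOn (divergence T) D :=
    ((continuous_divergence hT.contDiff).integrable_of_hasCompactSupport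
      (hasCompactSupport_divergence hT.hasCompactSupport)).integrableOn
  rw [← integral_inter_add_sdiff₀ (measurableSet_side n 1).nullMeasurableSet hint]
  -- The two sets differ only on the null hyperplane.
  have hae : (D \ side n 1 : Set _) =ᵐ[volume] (D ∩ side n (-1) : Set _) := by
    have : ∀ᵐ x : Space (n + 1), x 0 ≠ 0 := by
      rw [ae_iff]; simpa using volume_height_eq_zero n
    filter_upwards [this] with x hx
    refine propext (and_congr_right fun _ => ?_)
    simp only [side, mem_ofPred_eq]
    change ¬0 < 1 * x 0 ↔ 0 < -1 * x 0
    constructor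
    · intro h
      have : x 0 < 0 := lt_of_le_of_ne (by linarith) hx
      linarith
    · intro h; linarith
  rw [setIntegral_congr_set hae]
  linarith

/-! ### The trace on the interface -/

/-- The isometric embedding of `ℝ^n` as the hyperplane `{x₁ = 0}`. -/
def interfaceEmb (n : ℕ) (z : Space n) : Space (n + 1) := (splitEquiv n).symm (0, z)

theorem splitEquiv_interfaceEmb {n : ℕ} (z : Space n) :
    splitEquiv n (interfaceEmb n z) = (0, z) := (splitEquiv n).apply_symm_apply _

theorem isometry_interfaceEmb (n : ℕ) : Isometry (interfaceEmb n) := by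
  refine Isometry.of_dist_eq fun z w => ?_
  have h0 : ∀ z, interfaceEmb n z 0 = 0 := fun z => by
    rw [← splitEquiv_fst, splitEquiv_interfaceEmb]
  have h1 : ∀ z i, interfaceEmb n z (Fin.succ i) = z i := fun z i => by
    rw [← splitEquiv_snd, splitEquiv_interfaceEmb]
  rw [EuclideanSpace.dist_eq, EuclideanSpace.dist_eq, Fin.sum_univ_succ]
  simp [h0, h1]

theorem euclideanHausdorffMeasure_interface {n : ℕ} (s : Set (Space n)) :
    μHE[n] {x : Space (n + 1) | x 0 = 0 ∧ (splitEquiv n x).2 ∈ s} = volume s := by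
  have : {x : Space (n + 1) | x 0 = 0 ∧ (splitEquiv n x).2 ∈ s} = interfaceEmb n '' s := by
    ext x
    constructor
    · rintro ⟨h0, hs⟩
      refine ⟨_, hs, (splitEquiv n).injective ?_⟩
      rw [splitEquiv_interfaceEmb]
      exact Prod.ext h0.symm rfl
    · rintro ⟨z, hz, rfl⟩
      refine ⟨?_, ?_⟩
      · rw [← splitEquiv_fst, splitEquiv_interfaceEmb]
      · rwa [splitEquiv_interfaceEmb]
  rw [this, (isometry_interfaceEmb n).euclideanHausdorffMeasure_image,
    EuclideanSpace.euclideanHausdorffMeasure_eq_volume]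

theorem volume_closedBall_diff_closedBall {n : ℕ} {a b : ℝ} (ha : 0 ≤ a) (hab : a ≤ b) :
    volume (Metric.closedBall (0 : Space n) b \ Metric.closedBall 0 a) =
      ENNReal.ofReal (unitBallVolume n * (b ^ n - a ^ n)) := by
  rw [measure_sdiff (Metric.closedBall_subset_closedBall hab)
    measurableSet_closedBall.nullMeasurableSet measure_closedBall_lt_top.ne,
    ← ofReal_measureReal measure_closedBall_lt_top.ne,
    ← ofReal_measureReal measure_closedBall_lt_top.ne,
    ← ENNReal.ofReal_sub _ measureReal_nonneg, volume_real_closedBall_eq ha,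
    volume_real_closedBall_eq (ha.trans hab), mul_sub]

theorem volume_closedBall_diff_ball {n : ℕ} {a b : ℝ} (ha : 0 < a) (hab : a ≤ b) :
    volume (Metric.closedBall (0 : Space n) b \ Metric.ball 0 a) =
      ENNReal.ofReal (unitBallVolume n * (b ^ n - a ^ n)) := by
  rw [← volume_closedBall_diff_closedBall ha.le hab]
  refine measure_congr ?_
  refine (ae_eq_refl _).diff ?_
  have := Measure.addHaar_sphere_of_ne_zero (volume : Measure (Space n)) 0 ha.ne'
  rw [← Metric.ball_union_sphere]
  exact (union_ae_eq_left_of_ae_eq_empty (ae_eq_empty.2 this)).symm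

/-- The points x + στe₁ with τ ↓ 0 eventually lie in `D` and in the open side, hence in the closed
set `K`. -/
theorem mem_of_mem_nhds_of_inter_side_subset {n : ℕ} {D K : Set (Space (n + 1))} {σ : ℝ}
    (hσ : σ = 1 ∨ σ = -1) (hK : IsClosed K) (hDK : D ∩ side n σ ⊆ K) {x : Space (n + 1)}
    (hx0 : x 0 = 0) (hx : D ∈ 𝓝 x) : x ∈ K := by
  have hσ2 : σ * σ = 1 := by rcases hσ with rfl | rfl <;> norm_num
  have ht : Tendsto (fun τ : ℝ => x + EuclideanSpace.single (0 : Fin (n + 1)) (σ * τ))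
      (𝓝[>] 0) (𝓝 x) := by
    have hc : Continuous fun τ : ℝ => x + (σ * τ) • EuclideanSpace.single (0 : Fin (n + 1)) (1 : ℝ) := by
      fun_prop
    have := hc.tendsto 0
    simp only [mul_zero, zero_smul, add_zero] at this
    refine (this.mono_left nhdsWithin_le_nhds).congr fun τ => ?_
    congr 1
    ext i
    by_cases hi : i = 0 <;> simp [hi]
  refine hK.mem_of_tendsto ht ?_
  filter_upwards [ht hx, self_mem_nhdsWithin] with τ h1 h2
  refine hDK ⟨h1, ?_⟩
  change 0 < σ * (x + EuclideanSpace.single (0 : Fin (n + 1)) (σ * τ) : Space (n + 1)) 0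
  simp only [PiLp.add_apply, hx0, PiLp.single_apply, if_true, zero_add, ← mul_assoc, hσ2, one_mul]
  exact h2

/-- Two pieces, glued along the interface. -/
def glue (n : ℕ) (Km Kp : Set (Space (n + 1))) : Set (Space (n + 1)) :=
  (Km ∩ {x | x 0 ≤ 0}) ∪ (Kp ∩ {x | 0 ≤ x 0})

theorem glue_inter_side_left {n : ℕ} (Km Kp : Set (Space (n + 1))) :
    glue n Km Kp ∩ side n (-1) = Km ∩ side n (-1) := by
  ext x
  simp only [glue, side, mem_inter_iff, mem_union, mem_ofPred_eq]
  constructor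
  · rintro ⟨h | h, h2⟩
    · exact ⟨h.1, h2⟩
    · linarith [h.2]
  · rintro ⟨h, h2⟩
    exact ⟨Or.inl ⟨h, by linarith⟩, h2⟩

theorem glue_inter_side_right {n : ℕ} (Km Kp : Set (Space (n + 1))) :
    glue n Km Kp ∩ side n 1 = Kp ∩ side n 1 := by
  ext x
  simp only [glue, side, mem_inter_iff, mem_union, mem_ofPred_eq]
  constructor
  · rintro ⟨h | h, h2⟩
    · linarith [h.2]
    · exact ⟨h.1, h2⟩
  · rintro ⟨h, h2⟩
    exact ⟨Or.inr ⟨h, by linarith⟩, h2⟩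

theorem isClosed_glue {n : ℕ} {Km Kp : Set (Space (n + 1))} (hm : IsClosed Km)
    (hp : IsClosed Kp) : IsClosed (glue n Km Kp) :=
  (hm.inter (isClosed_le (by fun_prop) continuous_const)).union
    (hp.inter (isClosed_le continuous_const (by fun_prop)))

/-- `K` is closed and meets the interface in the closed disc of radius `a`, whose relative interior
is interior to `K`. -/
structure HasTrace {n : ℕ} (K : Set (Space (n + 1))) (a : ℝ) : Prop where
  isClosed : IsClosed K
  mem_iff : ∀ x : Space (n + 1), x 0 = 0 → (x ∈ K ↔ ‖(splitEquiv n x).2‖ ≤ a)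
  mem_nhds : ∀ x : Space (n + 1), x 0 = 0 → ‖(splitEquiv n x).2‖ < a → K ∈ 𝓝 x

theorem glue_mem_nhds {n : ℕ} {Km Kp : Set (Space (n + 1))} {x : Space (n + 1)}
    (hm : Km ∈ 𝓝 x) (hp : Kp ∈ 𝓝 x) : glue n Km Kp ∈ 𝓝 x := by
  filter_upwards [hm, hp] with y h1 h2
  exact (le_total (y 0) 0).imp (fun h => ⟨h1, h⟩) fun h => ⟨h2, h⟩

/-- Up to a null sphere this part of the frontier is the annulus between the two traces: a point of
both open discs is interior to the glued set, and an interior point on `Σ`, approached from either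
side, must lie in both traces. -/
theorem euclideanHausdorffMeasure_frontier_glue {n : ℕ} {Km Kp : Set (Space (n + 1))} {a b : ℝ}
    (ha : 0 < a) (hb : 0 < b) (hm : HasTrace Km a) (hp : HasTrace Kp b) :
    μHE[n] (frontier (glue n Km Kp) ∩ {x | x 0 = 0}) =
      ENNReal.ofReal (unitBallVolume n * |a ^ n - b ^ n|) := by
  have hclosed := isClosed_glue hm.isClosed hp.isClosed
  have habs : |a ^ n - b ^ n| = max a b ^ n - min a b ^ n := by
    rcases le_total a b with h | h
    · rw [max_eq_right h, min_eq_left h, abs_sub_comm, abs_of_nonneg]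
      exact sub_nonneg.2 (pow_le_pow_left₀ ha.le h n)
    · rw [max_eq_left h, min_eq_right h, abs_of_nonneg]
      exact sub_nonneg.2 (pow_le_pow_left₀ hb.le h n)
  have hlo : 0 < min a b := lt_min ha hb
  have hlohi : min a b ≤ max a b := min_le_max
  rw [habs]
  refine le_antisymm ?_ ?_
  -- The inner rim is kept in this upper bound and dropped in the lower one; it is null because its
  -- radius is positive.
  · rw [← volume_closedBall_diff_ball hlo hlohi, ← euclideanHausdorffMeasure_interface]
    refine measure_mono ?_
    rintro x ⟨hx, hx0⟩
    refine ⟨hx0, ?_, fun h => ?_⟩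
    · rw [mem_closedBall_zero_iff, le_max_iff]
      exact (hclosed.frontier_subset hx).imp (fun h => (hm.mem_iff x hx0).1 h.1)
        fun h => (hp.mem_iff x hx0).1 h.1
    · rw [mem_ball_zero_iff, lt_min_iff] at h
      exact hx.2 (mem_interior_iff_mem_nhds.2
        (glue_mem_nhds (hm.mem_nhds x hx0 h.1) (hp.mem_nhds x hx0 h.2)))
  · rw [← volume_closedBall_diff_closedBall hlo.le hlohi, ← euclideanHausdorffMeasure_interface]
    refine measure_mono ?_
    rintro x ⟨hx0, h1, h2⟩
    rw [mem_closedBall_zero_iff, le_max_iff] at h1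
    rw [mem_closedBall_zero_iff, not_le, min_lt_iff] at h2
    refine ⟨⟨subset_closure (h1.imp (fun h => ⟨(hm.mem_iff x hx0).2 h, le_of_eq hx0⟩)
      fun h => ⟨(hp.mem_iff x hx0).2 h, ge_of_eq hx0⟩), fun hint => ?_⟩, hx0⟩
    rw [mem_interior_iff_mem_nhds] at hint
    rcases h2 with h2 | h2
    · refine h2.not_ge ((hm.mem_iff x hx0).1 (mem_of_mem_nhds_of_inter_side_subset (Or.inr rfl)
        hm.isClosed ?_ hx0 hint))
      rw [glue_inter_side_left]; exact inter_subset_left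
    · refine h2.not_ge ((hp.mem_iff x hx0).1 (mem_of_mem_nhds_of_inter_side_subset (Or.inl rfl)
        hp.isClosed ?_ hx0 hint))
      rw [glue_inter_side_right]; exact inter_subset_left

/-! ### Volume preserving stretchings -/

/-- The diagonal `(s⁻ⁿ, s, …, s)`. -/
def stretch (n : ℕ) (s : ℝ) : Fin (n + 1) → ℝ := Fin.cons ((s ^ n)⁻¹) fun _ => s

theorem stretch_one (n : ℕ) : stretch n 1 = 1 := by
  ext i
  refine Fin.cases ?_ (fun j => ?_) i <;> simp [stretch]

theorem stretch_pos {n : ℕ} {s : ℝ} (hs : 0 < s) (i : Fin (n + 1)) : 0 < stretch n s i := by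
  refine Fin.cases ?_ (fun j => ?_) i
  · simp only [stretch, Fin.cons_zero]; positivity
  · simpa [stretch] using hs

theorem prod_stretch {n : ℕ} {s : ℝ} (hs : 0 < s) : ∏ i, stretch n s i = 1 := by
  rw [Fin.prod_univ_succ]
  simp only [stretch, Fin.cons_zero, Fin.cons_succ, Finset.prod_const, Finset.card_univ,
    Fintype.card_fin]
  exact inv_mul_cancel₀ (by positivity)

/-- A ball, stretched by `stretch n s`. -/
def stretchedBall (n : ℕ) (σ κ R s : ℝ) : Set (Space (n + 1)) :=
  diagMap (stretch n s)⁻¹ ⁻¹' capBall n σ κ R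

theorem hasTrace_stretchedBall {n : ℕ} {σ : ℝ} (hσ : σ = 1 ∨ σ = -1) {κ R s a : ℝ} (hR : 0 < R)
    (hs : 0 < s) (ha : 0 < a) (hRa : R ^ 2 - (R * κ) ^ 2 = a ^ 2) :
    HasTrace (stretchedBall n σ κ R s) (s * a) := by
  set c : Space (n + 1) := EuclideanSpace.single 0 (σ * (R * κ)) with hc
  have hσ2 : σ ^ 2 = 1 := by rcases hσ with rfl | rfl <;> norm_num
  have hnorm : ∀ x : Space (n + 1), x 0 = 0 → ‖diagMap (stretch n s)⁻¹ x - c‖ ^ 2 =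
      (R * κ) ^ 2 + (s⁻¹ * ‖(splitEquiv n x).2‖) ^ 2 := by
    intro x hx
    have h2 : (splitEquiv n (diagMap (stretch n s)⁻¹ x)).2 = s⁻¹ • (splitEquiv n x).2 := by
      ext i
      simp [splitEquiv_snd, stretch]
    rw [hc, norm_sub_single_sq, h2, norm_smul, Real.norm_eq_abs, abs_of_pos (inv_pos.2 hs),
      diagMap_apply, hx]
    linear_combination (R * κ) ^ 2 * hσ2
  refine ⟨Metric.isClosed_closedBall.preimage (diagMap _).continuous, fun x hx => ?_,
    fun x hx h => ?_⟩
  · rw [stretchedBall, mem_preimage, capBall, Metric.mem_closedBall, dist_eq_norm,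
      ← pow_le_pow_iff_left₀ (norm_nonneg _) hR.le two_ne_zero, hnorm x hx, ← inv_mul_le_iff₀ hs,
      ← pow_le_pow_iff_left₀ (by positivity) ha.le two_ne_zero, ← hRa]
    constructor <;> intro <;> linarith
  · rw [← inv_mul_lt_iff₀ hs, ← pow_lt_pow_iff_left₀ (by positivity) ha.le two_ne_zero, ← hRa] at h
    have : diagMap (stretch n s)⁻¹ x ∈ Metric.ball c R := by
      rw [Metric.mem_ball, dist_eq_norm, ← pow_lt_pow_iff_left₀ (norm_nonneg _) hR.le two_ne_zero,
        hnorm x hx]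
      linarith
    filter_upwards [(diagMap (stretch n s)⁻¹).continuous.continuousAt.preimage_mem_nhds
      (Metric.isOpen_ball.mem_nhds this)] with y hy
    rw [stretchedBall, mem_preimage, capBall]
    exact Metric.ball_subset_closedBall (mem_preimage.1 hy)

theorem volume_stretchedBall_inter_side {n : ℕ} (σ κ R : ℝ) {s : ℝ} (hs : 0 < s) :
    volume (stretchedBall n σ κ R s ∩ side n σ) = volume (capBall n σ κ R ∩ side n σ) := by
  rw [stretchedBall, preimage_inter_side (stretch_pos hs)]
  have hmp : MeasurePreserving (diagMap (stretch n s)⁻¹) :=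
    measurePreserving_diagMap (by
      simp only [Pi.inv_apply, Finset.prod_inv_distrib, prod_stretch hs, inv_one])
  have hmeas : MeasurableSet (capBall n σ κ R) := measurableSet_closedBall
  exact MeasurePreserving.measure_preimage hmp (hmeas.inter (measurableSet_side n σ)).nullMeasurableSet

theorem stretchedBall_one (n : ℕ) (σ κ R : ℝ) : stretchedBall n σ κ R 1 = capBall n σ κ R := by
  rw [stretchedBall, stretch_one]
  have : ∀ x : Space (n + 1), diagMap (1 : Fin (n + 1) → ℝ)⁻¹ x = x := fun x => by ext i; simp
  ext x
  rw [mem_preimage, this]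

/-! ### The first variation -/

theorem leftHalf_eq_side (n : ℕ) : leftHalf (n + 1) = side n (-1) := by
  ext x
  simp [leftHalf, side]

theorem rightHalf_eq_side (n : ℕ) : rightHalf (n + 1) = side n 1 := by
  ext x
  simp [rightHalf, side]

/-- The centres have height σRκ, so κ = cos α on the left (σ = -1) and κ = -cos β on the right (σ =
1). -/
theorem domes_eq_glue (n : ℕ) (α β Rm Rp : ℝ) :
    domes (n + 1) α β Rm Rp = glue n (stretchedBall n (-1) (Real.cos α) Rm 1)
      (stretchedBall n 1 (-Real.cos β) Rp 1) := by
  rw [stretchedBall_one, stretchedBall_one, domes, glue, capBall, capBall]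
  congr 5 <;> ring

/-- The bound `capFlux` gives for the area of the stretched cap. -/
def stretchedArea (n : ℕ) (σ κ R s : ℝ) : ℝ := capFlux n σ κ R (fluxWeight R (stretch n s))

theorem stretchedArea_nonneg {n : ℕ} (hn : n ≠ 0) {σ : ℝ} (hσ : σ = 1 ∨ σ = -1)
    (κ : ℝ) {R : ℝ} (hR : 0 < R) (s : ℝ) : 0 ≤ stretchedArea n σ κ R s :=
  capFlux_nonneg hn hσ κ hR fun i => by unfold fluxWeight; positivity

theorem sliceArea_zero {n : ℕ} {R κ a : ℝ} (ha : 0 < a) (hRa : R ^ 2 - (R * κ) ^ 2 = a ^ 2) :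
    sliceArea n R (R * κ) 0 = unitBallVolume n * a ^ n := by
  rw [sliceArea, zero_sub, neg_sq, hRa, Real.sqrt_sq ha.le]

/-- The weights are (1 + s²ⁿ)/(2R) once and (1 + s⁻²)/(2R) n times. Their sum is stationary at s =
1, so the volume term drops out and only the disc term, with derivative factor n/R, survives. -/
theorem hasDerivAt_stretchedArea (n : ℕ) (σ : ℝ) {κ R a : ℝ} (hR : 0 < R) (ha : 0 < a)
    (hRa : R ^ 2 - (R * κ) ^ 2 = a ^ 2) :
    HasDerivAt (stretchedArea n σ κ R) (-(n * κ * (unitBallVolume n * a ^ n))) 1 := by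
  have hform : stretchedArea n σ κ R = fun s =>
      ((1 + s ^ (2 * n)) / (2 * R) + n * ((1 + s⁻¹ ^ 2) / (2 * R))) *
        volume.real (capBall n σ κ R ∩ side n σ) -
      (1 + s ^ (2 * n)) / (2 * R) * (R * κ) * (unitBallVolume n * a ^ n) := by
    ext s
    rw [stretchedArea, capFlux, Fin.sum_univ_succ, sliceArea_zero ha hRa]
    simp only [fluxWeight, stretch, Fin.cons_zero, Fin.cons_succ, inv_inv, Finset.sum_const,
      Finset.card_univ, Fintype.card_fin, nsmul_eq_mul, ← pow_mul, mul_comm n 2]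
  rw [hform]
  have h1 : HasDerivAt (fun s : ℝ => (1 + s ^ (2 * n)) / (2 * R)) ((2 * n : ℕ) / (2 * R)) 1 := by
    have := (((hasDerivAt_pow (2 * n) (1 : ℝ))).const_add 1).div_const (2 * R)
    simpa using this
  have h2 : HasDerivAt (fun s : ℝ => n * ((1 + s⁻¹ ^ 2) / (2 * R))) (n * (-2 / (2 * R))) 1 := by
    have := ((((hasDerivAt_inv (one_ne_zero (α := ℝ))).pow 2).const_add 1).div_const
      (2 * R)).const_mul (n : ℝ)
    simpa using this
  refine (((h1.add h2).mul_const _).sub ((h1.mul_const _).mul_const _)).congr_deriv ?_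
  push_cast
  field_simp
  ring

theorem hasDerivAt_mul_pow (n : ℕ) (a : ℝ) :
    HasDerivAt (fun s : ℝ => (s * a) ^ n) (n * a ^ n) 1 := by
  simp_rw [mul_pow]
  simpa using (hasDerivAt_pow n (1 : ℝ)).mul_const (a ^ n)

/-- The derivative at s = 1 of the explicit function is nωaⁿ(±γ - ρκ), with the sign of a - b, and
it vanishes at the minimum. -/
theorem snell_of_forall_le {n : ℕ} (hn : n ≠ 0) (σ : ℝ) {κ R a b ρ γ : ℝ} (hR : 0 < R)
    (ha : 0 < a) (hb : 0 < b) (hRa : R ^ 2 - (R * κ) ^ 2 = a ^ 2)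
    (hmin : ∀ s > 0, ρ * stretchedArea n σ κ R 1 + γ * (unitBallVolume n * |a ^ n - b ^ n|) ≤
      ρ * stretchedArea n σ κ R s + γ * (unitBallVolume n * |(s * a) ^ n - b ^ n|)) :
    (b < a → ρ * κ = γ) ∧ (a < b → ρ * κ = -γ) := by
  have hU := (hasDerivAt_stretchedArea n σ hR ha hRa).const_mul ρ
  have hP := hasDerivAt_mul_pow n a
  have hV := unitBallVolume_pos n
  have hn' : (n : ℝ) ≠ 0 := Nat.cast_ne_zero.2 hn
  have hk : (n : ℝ) * (unitBallVolume n * a ^ n) ≠ 0 := by positivity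
  have hlocal : IsLocalMin (fun s => ρ * stretchedArea n σ κ R s +
      γ * (unitBallVolume n * |(s * a) ^ n - b ^ n|)) 1 := by
    filter_upwards [Ioi_mem_nhds (zero_lt_one (α := ℝ))] with s hs
    simpa using hmin s hs
  constructor
  · intro hab
    have hlt : 0 < (1 * a) ^ n - b ^ n := by
      rw [one_mul]; exact sub_pos.2 (pow_lt_pow_left₀ hab hb.le hn)
    -- The difference keeps its sign near s = 1, so the absolute value is differentiable there.
    have hd := hU.add (((((hP.sub_const (b ^ n)).congr_of_eventuallyEq
      (f₁ := fun s => |(s * a) ^ n - b ^ n|) (by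
        filter_upwards [(hP.sub_const (b ^ n)).continuousAt.eventually (lt_mem_nhds hlt)] with s hs
        exact abs_of_pos hs)).const_mul (unitBallVolume n))).const_mul γ)
    have h0 := hlocal.hasDerivAt_eq_zero hd
    have : (ρ * κ - γ) * (n * (unitBallVolume n * a ^ n)) = 0 := by linear_combination -h0
    exact sub_eq_zero.1 ((mul_eq_zero.1 this).resolve_right hk)
  · intro hab
    have hlt : (1 * a) ^ n - b ^ n < 0 := by
      rw [one_mul]; exact sub_neg.2 (pow_lt_pow_left₀ hab ha.le hn)
    have hd := hU.add (((((hP.sub_const (b ^ n)).neg.congr_of_eventuallyEq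
      (f₁ := fun s => |(s * a) ^ n - b ^ n|) (by
        filter_upwards [(hP.sub_const (b ^ n)).continuousAt.eventually (gt_mem_nhds hlt)] with s hs
        exact abs_of_neg hs)).const_mul (unitBallVolume n))).const_mul γ)
    have h0 := hlocal.hasDerivAt_eq_zero hd
    have : (ρ * κ + γ) * (n * (unitBallVolume n * a ^ n)) = 0 := by linear_combination -h0
    exact eq_neg_of_add_eq_zero_left ((mul_eq_zero.1 this).resolve_right hk)

/-! ### The weighted perimeter of stretched domes -/

/-- The explicit upper bound for the weighted perimeter of two stretched domes with traces of
radii `a` and `b`. -/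
def energyBound (n : ℕ) (ρm ρp γ κm κp Rm Rp a b s t : ℝ) : ℝ :=
  ρm * stretchedArea n (-1) κm Rm s + ρp * stretchedArea n 1 κp Rp t +
    γ * (unitBallVolume n * |(s * a) ^ n - (t * b) ^ n|)

section

variable {n : ℕ} {ρm ρp γ κm κp Rm Rp a b s t : ℝ}

theorem ofReal_energyBound (hn : n ≠ 0) (hρm : 0 ≤ ρm) (hρp : 0 ≤ ρp) (hγ : 0 ≤ γ) (hRm : 0 < Rm)
    (hRp : 0 < Rp) : ENNReal.ofReal (energyBound n ρm ρp γ κm κp Rm Rp a b s t) =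
      ENNReal.ofReal ρm * ENNReal.ofReal (stretchedArea n (-1) κm Rm s) +
      ENNReal.ofReal ρp * ENNReal.ofReal (stretchedArea n 1 κp Rp t) +
      ENNReal.ofReal γ * ENNReal.ofReal (unitBallVolume n * |(s * a) ^ n - (t * b) ^ n|) := by
  have h1 := stretchedArea_nonneg hn (Or.inr rfl) κm hRm s
  have h2 := stretchedArea_nonneg hn (Or.inl rfl) κp hRp t
  have h3 := unitBallVolume_pos n
  rw [← ENNReal.ofReal_mul hρm, ← ENNReal.ofReal_mul hρp, ← ENNReal.ofReal_mul hγ,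
    ← ENNReal.ofReal_add (by positivity) (by positivity),
    ← ENNReal.ofReal_add (by positivity) (by positivity), energyBound]

theorem weightedPerimeter_glue_le (hn : n ≠ 0) (hρm : 0 ≤ ρm) (hρp : 0 ≤ ρp) (hγ : 0 ≤ γ)
    (hRm : 0 < Rm) (hRp : 0 < Rp) (ha : 0 < a) (hb : 0 < b)
    (hRa : Rm ^ 2 - (Rm * κm) ^ 2 = a ^ 2) (hRb : Rp ^ 2 - (Rp * κp) ^ 2 = b ^ 2)
    (hs : 0 < s) (ht : 0 < t) :
    weightedPerimeter ρm ρp γ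
        (glue n (stretchedBall n (-1) κm Rm s) (stretchedBall n 1 κp Rp t)) ≤
      ENNReal.ofReal (energyBound n ρm ρp γ κm κp Rm Rp a b s t) := by
  rw [ofReal_energyBound hn hρm hρp hγ hRm hRp, weightedPerimeter, leftHalf_eq_side,
    rightHalf_eq_side]
  gcongr
  · exact perimeter_deformed_cap_le hn (Or.inr rfl) κm hRm (stretch_pos hs) (prod_stretch hs)
      (glue_inter_side_left _ _)
  · exact perimeter_deformed_cap_le hn (Or.inl rfl) κp hRp (stretch_pos ht) (prod_stretch ht)
      (glue_inter_side_right _ _)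
  · exact (euclideanHausdorffMeasure_frontier_glue (mul_pos hs ha) (mul_pos ht hb)
      (hasTrace_stretchedBall (Or.inr rfl) hRm hs ha hRa)
      (hasTrace_stretchedBall (Or.inl rfl) hRp ht hb hRb)).le

theorem ofReal_energyBound_le (hn : n ≠ 0) (hρm : 0 ≤ ρm) (hρp : 0 ≤ ρp) (hγ : 0 ≤ γ)
    (hRm : 0 < Rm) (hRp : 0 < Rp) (ha : 0 < a) (hb : 0 < b)
    (hRa : Rm ^ 2 - (Rm * κm) ^ 2 = a ^ 2) (hRb : Rp ^ 2 - (Rp * κp) ^ 2 = b ^ 2) :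
    ENNReal.ofReal (energyBound n ρm ρp γ κm κp Rm Rp a b 1 1) ≤ weightedPerimeter ρm ρp γ
        (glue n (stretchedBall n (-1) κm Rm 1) (stretchedBall n 1 κp Rp 1)) := by
  rw [ofReal_energyBound hn hρm hρp hγ hRm hRp, weightedPerimeter, leftHalf_eq_side,
    rightHalf_eq_side, stretchedArea, stretchedArea, stretch_one]
  gcongr
  · refine ofReal_capFlux_le_perimeter hn (Or.inr rfl) κm hRm ?_
    rw [glue_inter_side_left, stretchedBall_one]
  · refine ofReal_capFlux_le_perimeter hn (Or.inl rfl) κp hRp ?_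
    rw [glue_inter_side_right, stretchedBall_one]
  · exact (euclideanHausdorffMeasure_frontier_glue (mul_pos one_pos ha) (mul_pos one_pos hb)
      (hasTrace_stretchedBall (Or.inr rfl) hRm one_pos ha hRa)
      (hasTrace_stretchedBall (Or.inl rfl) hRp one_pos hb hRb)).ge

theorem isAdmissible_glue (hn : n ≠ 0) {Vm Vp : ℝ} (hRm : 0 < Rm) (hRp : 0 < Rp)
    (hs : 0 < s) (ht : 0 < t)
    (h : IsAdmissible ρm ρp Vm Vp
      (glue n (stretchedBall n (-1) κm Rm 1) (stretchedBall n 1 κp Rp 1))) :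
    IsAdmissible ρm ρp Vm Vp
      (glue n (stretchedBall n (-1) κm Rm s) (stretchedBall n 1 κp Rp t)) := by
  have hcl : ∀ σ κ R s, IsClosed (stretchedBall n σ κ R s) := fun σ κ R s =>
    Metric.isClosed_closedBall.preimage (diagMap _).continuous
  have hl := h.volume_left
  have hr := h.volume_right
  rw [leftHalf_eq_side, glue_inter_side_left, volume_stretchedBall_inter_side _ _ _ one_pos] at hl
  rw [rightHalf_eq_side, glue_inter_side_right, volume_stretchedBall_inter_side _ _ _ one_pos] at hr
  refine ⟨⟨(isClosed_glue (hcl _ _ _ _) (hcl _ _ _ _)).measurableSet.nullMeasurableSet, ?_⟩, ?_, ?_⟩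
  · exact perimeter_univ_lt_top hn hRp (stretch_pos ht) (prod_stretch ht)
      (glue_inter_side_right _ _) hRm (stretch_pos hs) (prod_stretch hs) (glue_inter_side_left _ _)
  · rw [leftHalf_eq_side, glue_inter_side_left, volume_stretchedBall_inter_side _ _ _ hs, hl]
  · rw [rightHalf_eq_side, glue_inter_side_right, volume_stretchedBall_inter_side _ _ _ ht, hr]

/-- The bound at (1, 1) is at most the energy of the domes, which by minimality is at most that of
the stretched domes, which is at most the bound at (s, t). -/
theorem energyBound_le (hn : n ≠ 0) {Vm Vp : ℝ} (hρm : 0 ≤ ρm) (hρp : 0 ≤ ρp) (hγ : 0 ≤ γ)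
    (hRm : 0 < Rm) (hRp : 0 < Rp) (ha : 0 < a) (hb : 0 < b)
    (hRa : Rm ^ 2 - (Rm * κm) ^ 2 = a ^ 2) (hRb : Rp ^ 2 - (Rp * κp) ^ 2 = b ^ 2)
    (hs : 0 < s) (ht : 0 < t)
    (h : IsMinimizer ρm ρp Vm Vp γ
      (glue n (stretchedBall n (-1) κm Rm 1) (stretchedBall n 1 κp Rp 1))) :
    energyBound n ρm ρp γ κm κp Rm Rp a b 1 1 ≤ energyBound n ρm ρp γ κm κp Rm Rp a b s t := by
  have h1 := stretchedArea_nonneg hn (Or.inr rfl) κm hRm s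
  have h2 := stretchedArea_nonneg hn (Or.inl rfl) κp hRp t
  have h3 := unitBallVolume_pos n
  refine (ENNReal.ofReal_le_ofReal_iff (by unfold energyBound; positivity)).1 ?_
  exact (ofReal_energyBound_le hn hρm hρp hγ hRm hRp ha hb hRa hRb).trans
    ((h.minimal _ (isAdmissible_glue hn hRm hRp hs ht h.admissible)).trans
      (weightedPerimeter_glue_le hn hρm hρp hγ hRm hRp ha hb hRa hRb hs ht))

end

theorem snell_law {n : ℕ} (hn : n ≠ 0) {ρm ρp Vm Vp γ : ℝ} (hρm : 0 < ρm) (hρp : 0 < ρp)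
    (hγ : 0 ≤ γ) {α β Rm Rp : ℝ}
    (hΩ : IsTypeIIMinimizer (n + 1) ρm ρp Vm Vp γ α β Rm Rp) :
    (Rp * Real.sin β < Rm * Real.sin α →
      ρm * Real.cos α = γ ∧ γ = ρp * Real.cos β) ∧
    (Rm * Real.sin α < Rp * Real.sin β →
      ρm * Real.cos α = -γ ∧ -γ = ρp * Real.cos β) := by
  have hRm := hΩ.radius_left_pos
  have hRp := hΩ.radius_right_pos
  have ha : 0 < Rm * Real.sin α := mul_pos hRm (Real.sin_pos_of_mem_Ioo hΩ.alpha_mem)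
  have hb : 0 < Rp * Real.sin β := mul_pos hRp (Real.sin_pos_of_mem_Ioo hΩ.beta_mem)
  have hRa : Rm ^ 2 - (Rm * Real.cos α) ^ 2 = (Rm * Real.sin α) ^ 2 := by
    rw [mul_pow, mul_pow, Real.sin_sq]; ring
  have hRb : Rp ^ 2 - (Rp * -Real.cos β) ^ 2 = (Rp * Real.sin β) ^ 2 := by
    rw [mul_pow, mul_pow, Real.sin_sq]; ring
  have hmin := hΩ.isMinimizer
  rw [domes_eq_glue] at hmin
  have hE := fun s t (hs : 0 < s) (ht : 0 < t) =>
    energyBound_le hn hρm.le hρp.le hγ hRm hRp ha hb hRa hRb hs ht hmin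
  obtain ⟨hm1, hm2⟩ := snell_of_forall_le hn (-1) hRm ha hb hRa (ρ := ρm) (γ := γ) fun s hs => by
    have := hE s 1 hs one_pos
    simp only [energyBound, one_mul] at this
    linarith
  -- The two radii exchange roles here; this reverses the sign of γ and is compensated by κ = -cos
  -- β.
  obtain ⟨hp1, hp2⟩ := snell_of_forall_le hn 1 hRp hb ha hRb (ρ := ρp) (γ := γ) fun t ht => by
    have := hE 1 t one_pos ht
    simp only [energyBound, one_mul] at this
    rw [abs_sub_comm, abs_sub_comm ((t * _) ^ n)]
    linarith
  refine ⟨fun h => ⟨hm1 h, ?_⟩, fun h => ⟨hm2 h, ?_⟩⟩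
  · linarith [hp2 h]
  · linarith [hp1 h]

end TwoPhase

end

theorem mainTheorem4 (N : ℕ) [NeZero N] (hN : 2 ≤ N)
    (ρm ρp Vm Vp γ : ℝ) (hρm : 0 < ρm) (hρp : 0 < ρp) (hVm : 0 < Vm) (hVp : 0 < Vp) (hγ : 0 ≤ γ)
    (α β Rm Rp : ℝ) (hΩ : TwoPhase.IsTypeIIMinimizer N ρm ρp Vm Vp γ α β Rm Rp) :
    (Rp * Real.sin β < Rm * Real.sin α →
      ρm * Real.cos α = γ ∧ γ = ρp * Real.cos β) ∧
    (Rm * Real.sin α < Rp * Real.sin β →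
      ρm * Real.cos α = -γ ∧ -γ = ρp * Real.cos β) := by
  obtain ⟨n, rfl⟩ : ∃ n, N = n + 1 := ⟨N - 1, by omega⟩
  exact TwoPhase.snell_law (by omega) hρm hρp hγ hΩ
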